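/- **Setting.** Fix a first-order signature of function symbols only, with equality $\approx$ as the only predicate, and an infinite set of variables. Equations are symmetric; a literal is $s\approx t$ or $s\not\approx t$ (generically $s\#t$), $\mathrm{comp}$ is complement, a clause is a finite multiset (disjunction) of implicitly universally quantified literals, and $\models$ is first-order entailment. A closure $C\cdot\sigma$ is a clause with a substitution that is grounding for it. Most general unifiers (mgus) are idempotent and introduce no fresh variables. Let $\prec_T$ be a well-founded rewrite ordering on terms that is total on ground terms and has only finitely many ground terms below each ground term. It is extended to literals through the multisets $\{s,t\}$ for $s\approx t$ and $\{s,s,t,t\}$ for $s\not\approx t$, to clauses by the multiset extension, and literals and clauses are compared with a term $\beta$ through $\{\beta\}$ and $\{\{\beta\}\}$. A trail is a sequence $\Gamma$ of ground literals $L\sigma$, each annotated with a level and a closure $(C\vee L)\cdot\sigma$. A ground literal $K$ is true (false) in $\Gamma$ if $\Gamma\models K$ ($\Gamma\models\mathrm{comp}(K)$), defined if it is true or false, undefined otherwise. A ground clause is true if one of its literals is, false if all are, undefined otherwise. "$\beta$-true/false/defined" means true/false/defined and $\prec_T\beta$; "$\beta$-undefined" means undefined or $\succ_T\beta$. $\mathrm{conv}(\Gamma)$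 is a convergent ground rewrite system, oriented by $\prec_T$, for the congruence generated by the positive equations of $\Gamma$. A trail literal is a decision literal if its level is one more than that of its predecessor (than $0$, if it is the first literal), and a propagated literal otherwise. A core of a defined literal $K$ is a minimal subsequence of $\Gamma$ in which $K$ is defined; the defining literal of $K$ is the last literal of a core whose last literal is earliest. The level of $K$ is its annotation if $K\in\Gamma$, else the level of its defining literal, and $0$ if there is none; the level of a clause is the maximal level of its literals ($0$ for the empty clause). The trail induced ordering $\prec_{\Gamma^*}$ on ground literals is as follows: $\beta$-defined literals precede $\beta$-undefined ones, which are ordered by $\prec_T$; among $\beta$-defined literals, those of level $0$ come first, ordered by $\prec_T$; those of positive level are ordered by the trail position of their defining literal, where at the position of a trail literal $L_i$ the order is $L_i$, then $\mathrm{comp}(L_i)$, then all others by $\prec_T$. It is extended to clauses by the multiset extension. A rewrite inference between variable-disjoint (renamed) closures $(l_1\approx r_1\vee C_1)\cdot\sigma_1$ and $(l_2\#r_2\vee C_2)\cdot\sigma_2$ with $r_1\sigma_1\prec_T l_1\sigma_1$ and $(l_2\#r_2)\sigma_2|_p=l_1\sigma_1$ yields $((l_2\#r_2)\delta[r_1]_p\,\mu\vee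 C_1\mu\vee C_2\delta\mu)\cdot\sigma_1\sigma_2\rho$ with distinguished literal $(l_2\#r_2)\delta[r_1]_p\,\mu$, where $\mu=\mathrm{mgu}((l_2\#r_2)\delta|_p,l_1)$; if $p$ is a position of $l_2\#r_2$, then $\delta$ and $\rho$ are the identity; otherwise $(l_2\#r_2)\delta$ is the most general instance that has position $p$, with $\delta$ acting on the variables of $l_2\#r_2$ and introducing only fresh variables, and $\rho$ is minimal with $(l_2\#r_2)\delta\sigma_2\rho=(l_2\#r_2)\sigma_2$. A reduction chain from a set of closures is a sequence of closures with distinguished literals, each of which is in the set or results from a rewrite inference between earlier ones. A reduction chain application from $\Gamma$ to a closure is a minimal reduction chain from that closure and those on $\Gamma$ whose last distinguished ground literal is the $\mathrm{conv}(\Gamma)$-normal form of the given ground literal. A refutation from $\Gamma$ and a closure whose literal is $\beta$-false in $\Gamma$ is a minimal such chain whose last ground literal is $s\not\approx s$ for some $s$. **The calculus SCL(EQ).** States are tuples $(\Gamma;N;U;\beta;k;D)$, with $N$ and $U$ sets of initial and learned clauses, $\beta$ a ground term, $k$ a level, and $D$ one of $\top$, $\bot$, or a closure. The rules, which leave all components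 that are not mentioned unchanged, are: * *Propagate* ($D=\top$). For $C=C_0\vee C_1\vee L\in N\cup U$ and $\sigma$ grounding for $C$ and irreducible by $\mathrm{conv}(\Gamma)$, with $C_0\sigma$ false in $\Gamma$, all literals of $C_1\sigma$ equal to $L\sigma$, $\mu$ the mgu of $L$ and the literals of $C_1$, $L\sigma$ $\beta$-undefined in $\Gamma$ and $(C_0\vee L)\mu\sigma\prec_T\beta$: append $(s_m\#t_m)\sigma_m$ with level $k$ and closure $(s_m\#t_m\vee C_m)\cdot\sigma_m$, the last element of a reduction chain application from $\Gamma$ to $(L\vee C_0)\mu\cdot\sigma$ with literal $L\mu$. * *Decide* ($D=\top$). For $C=C_0\vee L\in N\cup U$ and $\sigma$ grounding for $C$ and irreducible by $\mathrm{conv}(\Gamma)$, with $C_0\sigma$ $\beta$-undefined or $\beta$-true and $L\sigma$ $\beta$-undefined in $\Gamma$ and $C\sigma\prec_T\beta$: append $(s_m\#t_m)\sigma_m$ with level $k+1$ and closure $(s_m\#t_m\vee\mathrm{comp}(s_m\#t_m))\cdot\sigma_m$, where $s_m\#t_m$ and $\sigma_m$ come from the last element of a reduction chain application from $\Gamma$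 to $(L\vee C_0)\cdot\sigma$; set $k:=k+1$. * *Conflict* ($D=\top$). For $D'\in N\cup U$ and $\sigma$ grounding for $D'$ and irreducible by $\mathrm{conv}(\Gamma)$, with $D'\sigma$ $\beta$-false in $\Gamma$: set $D:=\bot$ if $D'\sigma$ is of level $0$, and $D:=D'\cdot\sigma$ otherwise. * *Skip* ($D=D'\cdot\sigma$, $\Gamma=\Gamma',K,L$ with $K$ of level $l$ and $L$ of level $k$). If $D'\sigma$ is $\beta$-false in $\Gamma',K$: remove $L$ from the trail and set $k:=l$. * *Explore-Refutation* ($D=(D'\vee s\#t)\cdot\sigma$). If $(s\#t)\sigma$ is strictly $\prec_{\Gamma^*}$-maximal in $(D'\vee s\#t)\sigma$ and has the last literal of $\Gamma$ as its defining literal: replace $D$ by a closure $(s_j\#t_j\vee C_j)\cdot\sigma_j$ that occurs in a refutation from $\Gamma$ and $D$ with literal $s\#t$, such that $(s_j\#t_j\vee C_j)\sigma_j\prec_{\Gamma^*}(D'\vee s\#t)\sigma$ and $(s_j\#t_j\vee C_j)\sigma_j$ is $\beta$-false in $\Gamma$. * *Factorize.* Replace $D=(D'\vee L\vee L')\cdot\sigma$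 with $L\sigma=L'\sigma$ by $(D'\vee L)\mu\cdot\sigma$, $\mu=\mathrm{mgu}(L,L')$. * *Equality-Resolution.* Replace $D=(D'\vee s\not\approx s')\cdot\sigma$ with $s\sigma=s'\sigma$ by $D'\mu\cdot\sigma$, $\mu=\mathrm{mgu}(s,s')$. * *Backtrack* ($D=(D'\vee L)\cdot\sigma$, $\Gamma=\Gamma_0,K,\Gamma'$). If $D'\sigma$ is of level $<k$, $K$ is of level $j$, and $\Gamma_0,K$ is the minimal prefix such that some ground instance of $D'\vee L$ is $\beta$-false in $\Gamma_0,K$ but not in $\Gamma_0$: go to $(\Gamma_0;N;U\cup\{D'\vee L\};\beta;j-i;\top)$, where $i=1$ if $K$ is a decision literal and $i=0$ otherwise. * *Grow* ($D=\top$). Go to $(\varepsilon;N;U;\beta';0;\top)$ for a ground term $\beta'$ with $\beta\prec_T\beta'$. A run is a finite sequence of rule applications starting in an initial state $(\varepsilon;N;\emptyset;\beta;0;\top)$, where $N$ is a clause set and $\beta$ a ground term. **Theorem (soundness).** Every state $(\Gamma;N;U;\beta;k;D)$ that results from a run is sound, that is: 1. $\Gamma$ is a consistent sequence of annotated ground literals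 (each annotating substitution is grounding for its clause). 2. For each decomposition $\Gamma=\Gamma_1,L\sigma^{i:(C\vee L)\cdot\sigma},\Gamma_2$ with $L\sigma$ a propagated literal: $C\sigma$ is $\beta$-false in $\Gamma_1$, $L\sigma$ is $\beta$-undefined in $\Gamma_1$ and irreducible by $\mathrm{conv}(\Gamma_1)$, $N\cup U\models C\vee L$, and $(C\vee L)\sigma\prec_T\beta$. 3. For each decomposition $\Gamma=\Gamma_1,L\sigma^{i:(C\vee L)\cdot\sigma},\Gamma_2$ with $L\sigma$ a decision literal: $C=\mathrm{comp}(L)$, $L\sigma$ is $\beta$-undefined in $\Gamma_1$ and irreducible by $\mathrm{conv}(\Gamma_1)$, $N\cup U\models L\vee\mathrm{comp}(L)$, and $(L\vee\mathrm{comp}(L))\sigma\prec_T\beta$. 4. $N\models U$. 5. If $D=C\cdot\sigma$, then $\sigma$ is grounding for $C$, $C\sigma$ is $\beta$-false in $\Gamma$ and $N\cup U\models C$; if $D=\bot$, then $N\cup U\models\bot$. -/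

import Mathlib

universe u v

namespace SCLEQ

/-! ### Terms, positions, substitutions

Terms over the function symbols of `L` and the variables `V` are Mathlib's `L.Term V`. -/

/-- A substitution: a total map from variables to terms. -/
abbrev Subst (L : FirstOrder.Language.{u, 0}) (V : Type v) := V → L.Term V

section Terms

variable {L : FirstOrder.Language.{u, 0}} {V : Type v}

/-- The variables of a term. -/
def vars : L.Term V → Set V
  | .var x => {x}
  | .func _ ts => ⋃ i, vars (ts i)

def IsGround (t : L.Term V) : Prop := vars t = ∅

/-- Composition `στ` of substitutions: first `σ`, then `τ`. -/
def Subst.comp (σ τ : Subst L V) : Subst L V := fun x => (σ x).subst τ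

def Subst.dom (σ : Subst L V) : Set V := {x | σ x ≠ .var x}

open Classical in
/-- The restriction of the domain of `σ` to `X`. -/
noncomputable def Subst.restrict (σ : Subst L V) (X : Set V) : Subst L V :=
  fun x => if x ∈ X then σ x else .var x

/-- `subtermAt p t` is the subterm `t|_p`, or `none` if `p` is not a position of `t`
(arguments are numbered from `0`). -/
def subtermAt : List ℕ → L.Term V → Option (L.Term V)
  | [], t => some t
  | _ :: _, .var _ => none
  | i :: p, @FirstOrder.Language.Term.func _ _ n _ ts => if h : i < n then subtermAt p (ts ⟨i, h⟩) else none

/-- `p` is a position of `t`. -/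
def IsPos (p : List ℕ) (t : L.Term V) : Prop := (subtermAt p t).isSome

/-- `replaceAt p s t` is `t[s]_p` (and `t` itself if `p` is not a position of `t`). -/
def replaceAt : List ℕ → L.Term V → L.Term V → L.Term V
  | [], s, _ => s
  | _ :: _, _, .var x => .var x
  | i :: p, s, @FirstOrder.Language.Term.func _ _ n f ts =>
      if h : i < n then .func f (Function.update ts ⟨i, h⟩ (replaceAt p s (ts ⟨i, h⟩)))
      else .func f ts

/-- `μ` unifies all pairs of terms in `E`. -/
def Unifies (μ : Subst L V) (E : Set (L.Term V × L.Term V)) : Prop :=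
  ∀ e ∈ E, e.1.subst μ = e.2.subst μ

/-- `μ` is a most general unifier of all pairs of terms in `E`; mgus are idempotent and
introduce no fresh variables. -/
structure IsMGU (μ : Subst L V) (E : Set (L.Term V × L.Term V)) : Prop where
  unifies : Unifies μ E
  most_general : ∀ τ : Subst L V, Unifies τ E → ∃ ρ : Subst L V, τ = μ.comp ρ
  idempotent : μ.comp μ = μ
  no_fresh : ∀ x, ∀ y ∈ vars (μ x), y = x ∨ ∃ e ∈ E, y ∈ vars e.1 ∪ vars e.2

/-! ### Rewriting -/

/-- A term rewrite system, as the set of its rules `l → r`. -/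
abbrev TRS (L : FirstOrder.Language.{u, 0}) (V : Type v) := Set (L.Term V × L.Term V)

/-- The one-step rewrite relation of `R`. -/
def Rewrites (R : TRS L V) (s t : L.Term V) : Prop :=
  ∃ rule ∈ R, ∃ (p : List ℕ) (σ : Subst L V),
    subtermAt p s = some (rule.1.subst σ) ∧ t = replaceAt p (rule.2.subst σ) s

def IrreducibleTerm (R : TRS L V) (s : L.Term V) : Prop := ∀ t, ¬ Rewrites R s t

/-- `s` is a normal form of `t` with respect to `R`. -/
def IsNormalForm (R : TRS L V) (t s : L.Term V) : Prop :=
  Relation.ReflTransGen (Rewrites R) t s ∧ IrreducibleTerm R s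

/-- All terms in the codomain of `σ` are irreducible. -/
def IrreducibleSubst (R : TRS L V) (σ : Subst L V) : Prop :=
  ∀ x ∈ σ.dom, IrreducibleTerm R (σ x)

/-- `prec` is a desired term ordering: a well-founded rewrite ordering that is total on ground
terms and has only finitely many ground terms below each ground term. -/
structure IsDesired (prec : L.Term V → L.Term V → Prop) : Prop where
  irrefl : ∀ t, ¬ prec t t
  trans : ∀ s t r, prec s t → prec t r → prec s r
  context : ∀ {n : ℕ} (f : L.Functions n) (ts : Fin n → L.Term V) (i : Fin n) (s t : L.Term V),
    prec s t → prec (.func f (Function.update ts i s)) (.func f (Function.update ts i t))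
  subst : ∀ (σ : Subst L V) (s t : L.Term V), prec s t → prec (s.subst σ) (t.subst σ)
  wf : WellFounded prec
  total : ∀ s t, IsGround s → IsGround t → prec s t ∨ s = t ∨ prec t s
  finite_below : ∀ t, IsGround t → {s | IsGround s ∧ prec s t}.Finite

end Terms

/-- The multiset extension of a relation: `M` is smaller than `M'` if `M` arises from `M'` by
replacing a nonempty submultiset by finitely many elements, each of them smaller than one of the
removed elements. -/
def MulExt {α : Type*} (r : α → α → Prop) (M M' : Multiset α) : Prop :=
  ∃ X Y Z : Multiset α, Z ≠ 0 ∧ M = X + Y ∧ M' = X + Z ∧ ∀ y ∈ Y, ∃ z ∈ Z, r y z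

/-! ### Literals and clauses -/

/-- An equational literal `s ≈ t` (`pos = true`) or `s ≉ t` (`pos = false`). Equations are
symmetric, so the atom is an unordered pair. -/
structure Lit (L : FirstOrder.Language.{u, 0}) (V : Type v) where
  pos : Bool
  atom : Sym2 (L.Term V)

/-- A clause is a finite multiset of literals, read as their disjunction. -/
abbrev Clause (L : FirstOrder.Language.{u, 0}) (V : Type v) := Multiset (Lit L V)

section Literals

variable {L : FirstOrder.Language.{u, 0}} {V : Type v}

/-- The literal `s # t` with the given sign. -/
def mkLit (b : Bool) (s t : L.Term V) : Lit L V := ⟨b, s(s, t)⟩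

/-- The complement of a literal. -/
def Lit.comp (K : Lit L V) : Lit L V := ⟨!K.pos, K.atom⟩

def Lit.subst (K : Lit L V) (σ : Subst L V) : Lit L V := ⟨K.pos, K.atom.map (·.subst σ)⟩

def Lit.vars (K : Lit L V) : Set V := {x | ∃ t ∈ K.atom, x ∈ SCLEQ.vars t}

def Lit.IsGround (K : Lit L V) : Prop := ∀ t ∈ K.atom, SCLEQ.IsGround t

/-- A literal is irreducible if both of its terms are. -/
def Lit.Irreducible (R : TRS L V) (K : Lit L V) : Prop := ∀ t ∈ K.atom, IrreducibleTerm R t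

/-- The multiset `{s, t}` for `s ≈ t` and `{s, s, t, t}` for `s ≉ t`. -/
def Lit.toMS (K : Lit L V) : Multiset (L.Term V) :=
  if K.pos then K.atom.toMultiset else K.atom.toMultiset + K.atom.toMultiset

/-- Truth of a literal in a structure under an assignment. -/
def Lit.Holds {M : Type*} [L.Structure M] (K : Lit L V) (a : V → M) : Prop :=
  if K.pos then (K.atom.map (·.realize a)).IsDiag else ¬ (K.atom.map (·.realize a)).IsDiag

def clauseSubst (C : Clause L V) (σ : Subst L V) : Clause L V := C.map (·.subst σ)

def clauseVars (C : Clause L V) : Set V := {x | ∃ K ∈ C, x ∈ K.vars}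

def clauseGround (C : Clause L V) : Prop := ∀ K ∈ C, K.IsGround

/-- `σ` is grounding for `C`. -/
def Grounding (σ : Subst L V) (C : Clause L V) : Prop := clauseGround (clauseSubst C σ)

/-- The universal closure of `C` holds in `M`. -/
def ModelsClause (M : Type*) [L.Structure M] (C : Clause L V) : Prop :=
  ∀ a : V → M, ∃ K ∈ C, K.Holds a

/-- Semantic entailment `N ⊨ C` (all clauses are implicitly universally quantified). By the
Löwenheim-Skolem theorem, structures in the universe of the signature suffice. -/
def Entails (N : Set (Clause L V)) (C : Clause L V) : Prop :=
  ∀ (M : Type u) [L.Structure M] [Nonempty M], (∀ C' ∈ N, ModelsClause M C') → ModelsClause M C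

/-- Entailment of a literal by a set of (ground) literals. -/
def LitEntails (G : Set (Lit L V)) (K : Lit L V) : Prop :=
  Entails ((fun H => ({H} : Clause L V)) '' G) {K}

/-- A set of (ground) literals is consistent if it has a model. -/
def Consistent (G : Set (Lit L V)) : Prop :=
  ∃ (M : Type u) (_ : L.Structure M) (_ : Nonempty M),
    ∀ K ∈ G, ModelsClause M ({K} : Clause L V)

/-! Truth values of ground literals and clauses with respect to a set `G` of ground literals. -/

def LitTrue (G : Set (Lit L V)) (K : Lit L V) : Prop := LitEntails G K
def LitFalse (G : Set (Lit L V)) (K : Lit L V) : Prop := LitEntails G K.comp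
def LitDefined (G : Set (Lit L V)) (K : Lit L V) : Prop := LitTrue G K ∨ LitFalse G K
def LitUndefined (G : Set (Lit L V)) (K : Lit L V) : Prop := ¬ LitDefined G K

def ClauseTrue (G : Set (Lit L V)) (C : Clause L V) : Prop := ∃ K ∈ C, LitTrue G K
def ClauseFalse (G : Set (Lit L V)) (C : Clause L V) : Prop := ∀ K ∈ C, LitFalse G K
def ClauseUndefined (G : Set (Lit L V)) (C : Clause L V) : Prop :=
  ¬ ClauseTrue G C ∧ ¬ ClauseFalse G C

section Ordering

variable (prec : L.Term V → L.Term V → Prop)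

/-- The term ordering extended to literals. -/
def litPrec (K H : Lit L V) : Prop := MulExt prec K.toMS H.toMS

/-- `K ≺_T β` for a literal `K` and a term `β`. -/
def litBelow (K : Lit L V) (β : L.Term V) : Prop := MulExt prec K.toMS {β}

/-- `C ≺_T β` for a clause `C` and a term `β`. -/
def clauseBelow (C : Clause L V) (β : L.Term V) : Prop :=
  MulExt (MulExt prec) (C.map Lit.toMS) {{β}}

/-- `β ≺_T C` for a clause `C` and a term `β`. -/
def clauseAbove (C : Clause L V) (β : L.Term V) : Prop :=
  MulExt (MulExt prec) {{β}} (C.map Lit.toMS)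

/-! The notions of truth relative to the bound `β`. -/

def LitBUndefined (β : L.Term V) (G : Set (Lit L V)) (K : Lit L V) : Prop :=
  MulExt prec {β} K.toMS ∨ LitUndefined G K
def LitBDefined (β : L.Term V) (G : Set (Lit L V)) (K : Lit L V) : Prop :=
  litBelow prec K β ∧ LitDefined G K
def LitBFalse (β : L.Term V) (G : Set (Lit L V)) (K : Lit L V) : Prop :=
  litBelow prec K β ∧ LitFalse G K

def ClauseBTrue (β : L.Term V) (G : Set (Lit L V)) (C : Clause L V) : Prop :=
  clauseBelow prec C β ∧ ClauseTrue G C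
def ClauseBFalse (β : L.Term V) (G : Set (Lit L V)) (C : Clause L V) : Prop :=
  clauseBelow prec C β ∧ ClauseFalse G C
def ClauseBUndefined (β : L.Term V) (G : Set (Lit L V)) (C : Clause L V) : Prop :=
  clauseAbove prec C β ∨ ClauseUndefined G C

/-- The rewrite system `conv(G)`: all ground rules `l → r` with `r ≺_T l` such that `l ≈ r` follows
from the positive equations in `G`. For a desired ordering it is convergent, and a ground term is
irreducible iff it is the least element of its congruence class. Every convergent system of
rules that are ground, oriented by `≺_T`, and generate the congruence of the positive equations
in `G` has the same irreducible terms and the same normal forms. -/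
def conv (G : Set (Lit L V)) : TRS L V :=
  {rule | IsGround rule.1 ∧ IsGround rule.2 ∧ prec rule.2 rule.1 ∧
    LitEntails {K ∈ G | K.pos = true} (mkLit true rule.1 rule.2)}

/-- `H` is the literal `K` with both terms replaced by their normal forms. -/
def LitNormalForm (R : TRS L V) (K H : Lit L V) : Prop :=
  ∃ s t s' t', K = mkLit K.pos s t ∧ H = mkLit K.pos s' t' ∧
    IsNormalForm R s s' ∧ IsNormalForm R t t'

end Ordering

end Literals

/-! ### Trails -/

/-- A closure `(lit ∨ rest)·subst` with a distinguished literal. -/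
structure LitClosure (L : FirstOrder.Language.{u, 0}) (V : Type v) where
  lit : Lit L V
  rest : Clause L V
  subst : Subst L V

/-- An annotated ground literal: the closure `(lit ∨ rest)·subst` and the level annotate the
ground literal `lit·subst`. -/
structure AnnLit (L : FirstOrder.Language.{u, 0}) (V : Type v) where
  closure : LitClosure L V
  level : ℕ

/-- A sequence of annotated literals, the most recent one last. -/
abbrev Trail (L : FirstOrder.Language.{u, 0}) (V : Type v) := List (AnnLit L V)

section Trails

variable {L : FirstOrder.Language.{u, 0}} {V : Type v}

/-- The clause `lit ∨ rest`. -/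
def LitClosure.clause (c : LitClosure L V) : Clause L V := c.lit ::ₘ c.rest

/-- The distinguished literal after instantiation. -/
def LitClosure.inst (c : LitClosure L V) : Lit L V := c.lit.subst c.subst

def LitClosure.vars (c : LitClosure L V) : Set V := clauseVars c.clause

/-- Renaming of variables in a closure; the ground instance does not change. -/
def LitClosure.rename (c : LitClosure L V) (ρ : Equiv.Perm V) : LitClosure L V where
  lit := c.lit.subst (fun x => .var (ρ x))
  rest := clauseSubst c.rest (fun x => .var (ρ x))
  subst := fun x => c.subst (ρ.symm x)

def AnnLit.inst (e : AnnLit L V) : Lit L V := e.closure.inst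

/-- The set of ground literals of a trail. -/
def lits (Γ : Trail L V) : Set (Lit L V) := {K | ∃ e ∈ Γ, e.inst = K}

/-- The level of the last literal of a trail, which is `0` for the empty trail. -/
def lastLevel (Γ : Trail L V) : ℕ := (Γ.getLast?.map AnnLit.level).getD 0

/-- The entry `e` following the trail prefix `Γ` is a decision literal: its level is one more than
the level before. All other entries are propagated literals. -/
def IsDecision (Γ : Trail L V) (e : AnnLit L V) : Prop := e.level = lastLevel Γ + 1

/-- The literals of the subsequence of `Γ` given by a set of indices. -/
def subLits (Γ : Trail L V) (S : Set (Fin Γ.length)) : Set (Lit L V) :=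
  {K | ∃ i ∈ S, (Γ.get i).inst = K}

/-- The subsequence given by `S` is a core of `K`: a minimal one in which `K` is defined. -/
def IsCore (Γ : Trail L V) (K : Lit L V) (S : Set (Fin Γ.length)) : Prop :=
  LitDefined (subLits Γ S) K ∧ ∀ S', S' ⊂ S → ¬ LitDefined (subLits Γ S') K

/-- The `i`-th literal of `Γ` is the defining literal of `K`: it is the greatest literal of some
core of `K`, and the greatest literal of every core of `K` is at least as great. -/
def IsDefining (Γ : Trail L V) (K : Lit L V) (i : Fin Γ.length) : Prop :=
  ∃ S, IsCore Γ K S ∧ IsGreatest S i ∧ ∀ S', IsCore Γ K S' → ∃ j, IsGreatest S' j ∧ i ≤ j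

/-- The ground literal `K` is of level `n` in `Γ`. -/
def LitLevel (Γ : Trail L V) (K : Lit L V) (n : ℕ) : Prop :=
  (∃ e ∈ Γ, e.inst = K ∧ e.level = n) ∨
  (K ∉ lits Γ ∧ LitDefined (lits Γ) K ∧
    ((∃ i, IsDefining Γ K i ∧ (Γ.get i).level = n) ∨
      ((¬ ∃ i, IsDefining Γ K i) ∧ n = 0)))

/-- The ground clause `C` is of level `n`: the maximal level of its literals is `n` (and the
empty clause is of level `0`). -/
def ClauseLevel (Γ : Trail L V) (C : Clause L V) (n : ℕ) : Prop :=
  (∀ K ∈ C, ∃ m ≤ n, LitLevel Γ K m) ∧ (n = 0 ∨ ∃ K ∈ C, LitLevel Γ K n)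

/-! ### The trail induced ordering -/

variable (prec : L.Term V → L.Term V → Prop)

/-- `K` is one of the literals `M_{i,j}`: a `β`-defined ground literal with `i`-th trail literal as
defining literal such that neither it nor its complement is on the trail. -/
def IsImplied (β : L.Term V) (Γ : Trail L V) (K : Lit L V) (i : Fin Γ.length) : Prop :=
  K.IsGround ∧ LitBDefined prec β (lits Γ) K ∧ K ∉ lits Γ ∧ K.comp ∉ lits Γ ∧ IsDefining Γ K i

def PosLevel (Γ : Trail L V) (K : Lit L V) : Prop := ∃ n, 0 < n ∧ LitLevel Γ K n

/-- The trail induced ordering on ground literals. -/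
inductive TrailPrec (β : L.Term V) (Γ : Trail L V) : Lit L V → Lit L V → Prop
  | implied_implied {K H : Lit L V} {i k : Fin Γ.length} :
      PosLevel Γ K → PosLevel Γ H → IsImplied prec β Γ K i → IsImplied prec β Γ H k →
      (i < k ∨ (i = k ∧ litPrec prec K H)) → TrailPrec β Γ K H
  | lit_lit {i j : Fin Γ.length} :
      PosLevel Γ (Γ.get i).inst → PosLevel Γ (Γ.get j).inst → i < j →
      TrailPrec β Γ (Γ.get i).inst (Γ.get j).inst
  | comp_lit {i j : Fin Γ.length} :
      PosLevel Γ (Γ.get i).inst.comp → PosLevel Γ (Γ.get j).inst → i < j →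
      TrailPrec β Γ (Γ.get i).inst.comp (Γ.get j).inst
  | lit_comp {i j : Fin Γ.length} :
      PosLevel Γ (Γ.get i).inst → PosLevel Γ (Γ.get j).inst.comp → i ≤ j →
      TrailPrec β Γ (Γ.get i).inst (Γ.get j).inst.comp
  | comp_comp {i j : Fin Γ.length} :
      PosLevel Γ (Γ.get i).inst.comp → PosLevel Γ (Γ.get j).inst.comp → i < j →
      TrailPrec β Γ (Γ.get i).inst.comp (Γ.get j).inst.comp
  | lit_implied {K : Lit L V} {i k : Fin Γ.length} :
      PosLevel Γ (Γ.get i).inst → PosLevel Γ K → IsImplied prec β Γ K k → i ≤ k →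
      TrailPrec β Γ (Γ.get i).inst K
  | comp_implied {K : Lit L V} {i k : Fin Γ.length} :
      PosLevel Γ (Γ.get i).inst.comp → PosLevel Γ K → IsImplied prec β Γ K k → i ≤ k →
      TrailPrec β Γ (Γ.get i).inst.comp K
  | implied_lit {K : Lit L V} {i k : Fin Γ.length} :
      PosLevel Γ K → PosLevel Γ (Γ.get i).inst → IsImplied prec β Γ K k → k < i →
      TrailPrec β Γ K (Γ.get i).inst
  | implied_comp {K : Lit L V} {i k : Fin Γ.length} :
      PosLevel Γ K → PosLevel Γ (Γ.get i).inst.comp → IsImplied prec β Γ K k → k < i →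
      TrailPrec β Γ K (Γ.get i).inst.comp
  | zero_zero {K H : Lit L V} : K.IsGround → H.IsGround →
      LitBDefined prec β (lits Γ) K → LitBDefined prec β (lits Γ) H →
      LitLevel Γ K 0 → LitLevel Γ H 0 → litPrec prec K H → TrailPrec β Γ K H
  | zero_pos {K H : Lit L V} : K.IsGround → H.IsGround →
      LitBDefined prec β (lits Γ) K → LitBDefined prec β (lits Γ) H →
      LitLevel Γ K 0 → PosLevel Γ H → TrailPrec β Γ K H
  | undef_undef {K H : Lit L V} : K.IsGround → H.IsGround →
      LitBUndefined prec β (lits Γ) K → LitBUndefined prec β (lits Γ) H →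
      litPrec prec K H → TrailPrec β Γ K H
  | def_undef {K H : Lit L V} : K.IsGround → H.IsGround →
      LitBDefined prec β (lits Γ) K → LitBUndefined prec β (lits Γ) H → TrailPrec β Γ K H

/-! ### Rewrite inferences, reduction chains, refutations -/

/-- `out` is the closure that results from a rewrite inference with the variable disjoint closures
`c₁ = (l₁ ≈ r₁ ∨ C₁)·σ₁` and `c₂ = (l₂ # r₂ ∨ C₂)·σ₂` at position `p`. Since equations are unordered
pairs, the side of the second literal that contains `p` may be called `l₂`. As usual for closures,
the domains of `σ₁` and `σ₂` are restricted to the variables of their clauses before composing them.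

In the first alternative `p` is a position of `l₂`. In the second one it lies below a variable, and
`l₂ # r₂` is first instantiated by the most general `δ` that makes `p` a position and introduces only
fresh variables; `ρ` grounds the fresh variables. -/
def DisjointRewriteInference (c₁ c₂ : LitClosure L V) (p : List ℕ) (out : LitClosure L V) : Prop :=
  ∃ (b : Bool) (l₁ r₁ l₂ r₂ s : L.Term V) (δ ρ μ : Subst L V),
    c₁.lit = mkLit true l₁ r₁ ∧ c₂.lit = mkLit b l₂ r₂ ∧
    Disjoint c₁.vars c₂.vars ∧
    prec (r₁.subst c₁.subst) (l₁.subst c₁.subst) ∧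
    subtermAt p (l₂.subst c₂.subst) = some (l₁.subst c₁.subst) ∧
    (let σ₁ := c₁.subst.restrict c₁.vars
     let σ₂ := c₂.subst.restrict c₂.vars
     let IsInstance (δ' ρ' : Subst L V) : Prop := IsPos p (l₂.subst δ') ∧
       ((l₂.subst δ').subst σ₂).subst ρ' = l₂.subst σ₂ ∧
       ((r₂.subst δ').subst σ₂).subst ρ' = r₂.subst σ₂
     ((IsPos p l₂ ∧ δ = (fun x => .var x) ∧ ρ = (fun x => .var x)) ∨
       (¬ IsPos p l₂ ∧ δ.dom ⊆ vars l₂ ∪ vars r₂ ∧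
        (∀ x ∈ δ.dom, Disjoint (vars (δ x)) (c₁.vars ∪ c₂.vars)) ∧
        IsInstance δ ρ ∧
        (∀ ρ', IsInstance δ ρ' → ρ.dom ⊆ ρ'.dom) ∧
        (∀ δ' ρ', IsInstance δ' ρ' →
          ∃ τ : Subst L V, (l₂.subst δ).subst τ = l₂.subst δ' ∧
            (r₂.subst δ).subst τ = r₂.subst δ'))) ∧
     subtermAt p (l₂.subst δ) = some s ∧ IsMGU μ {(s, l₁)} ∧
     out.lit = mkLit b ((replaceAt p r₁ (l₂.subst δ)).subst μ) ((r₂.subst δ).subst μ) ∧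
     out.rest = clauseSubst c₁.rest μ + clauseSubst (clauseSubst c₂.rest δ) μ ∧
     out.subst = (σ₁.comp σ₂).comp ρ)

/-- A rewrite inference; its premises are first made variable disjoint by renaming. -/
def RewriteInference (c₁ c₂ : LitClosure L V) (p : List ℕ) (out : LitClosure L V) : Prop :=
  ∃ ρ₁ ρ₂ : Equiv.Perm V, DisjointRewriteInference prec (c₁.rename ρ₁) (c₂.rename ρ₂) p out

end Trails

/-- A rewrite step: a closure with a distinguished literal, together with either no premises or two
premises and a position. -/
inductive RewriteStep (L : FirstOrder.Language.{u, 0}) (V : Type v) : Type (max u v)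
  | leaf (c : LitClosure L V) : RewriteStep L V
  | infer (c : LitClosure L V) (R S : RewriteStep L V) (p : List ℕ) : RewriteStep L V

section Chains

variable {L : FirstOrder.Language.{u, 0}} {V : Type v}

def RewriteStep.closure : RewriteStep L V → LitClosure L V
  | .leaf c => c
  | .infer c _ _ _ => c

variable (prec : L.Term V → L.Term V → Prop)

/-- A rewrite step is an available closure or results from a rewrite inference with previous
rewrite steps. -/
def RewriteStep.Justified (avail : Set (LitClosure L V)) (previous : List (RewriteStep L V)) :
    RewriteStep L V → Prop
  | .leaf c => c ∈ avail
  | .infer c R S p => R ∈ previous ∧ S ∈ previous ∧ RewriteInference prec R.closure S.closure p c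

/-- A reduction chain from the closures in `avail`. -/
def ReductionChain (avail : Set (LitClosure L V)) (P : List (RewriteStep L V)) : Prop :=
  ∀ P₁ I P₂, P = P₁ ++ I :: P₂ → I.Justified prec avail P₁

/-- The closures annotated on `Γ`, and `c`. -/
def available (Γ : Trail L V) (c : LitClosure L V) : Set (LitClosure L V) :=
  {c' | c' = c ∨ ∃ e ∈ Γ, e.closure = c'}

/-- A reduction chain from `Γ, c` whose last literal is the `conv(Γ)`-normal form of the literal
of `c`. -/
def ReducesLit (Γ : Trail L V) (c : LitClosure L V) (P : List (RewriteStep L V)) : Prop :=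
  ReductionChain prec (available Γ c) P ∧
  ∃ I, P.getLast? = some I ∧ LitNormalForm (conv prec (lits Γ)) c.inst I.closure.inst

/-- A (minimal) reduction chain application from `Γ` to the literal of `c`. -/
def ReductionChainApplication (Γ : Trail L V) (c : LitClosure L V)
    (P : List (RewriteStep L V)) : Prop :=
  ReducesLit prec Γ c P ∧ ∀ i < P.length, ¬ ReducesLit prec Γ c (P.eraseIdx i)

/-- A reduction chain from `Γ, c` whose last literal has the ground instance `s ≉ s`. -/
def RefutesLit (Γ : Trail L V) (c : LitClosure L V) (P : List (RewriteStep L V)) : Prop :=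
  ReductionChain prec (available Γ c) P ∧
  ∃ I, P.getLast? = some I ∧ ∃ s, I.closure.inst = mkLit false s s

/-- A (minimal) refutation from `Γ` and the literal of `c`, which must be `β`-false in `Γ`. -/
def Refutation (β : L.Term V) (Γ : Trail L V) (c : LitClosure L V)
    (P : List (RewriteStep L V)) : Prop :=
  LitBFalse prec β (lits Γ) c.inst ∧ RefutesLit prec Γ c P ∧
  ∀ i, i + 1 < P.length → ¬ RefutesLit prec Γ c (P.eraseIdx i)

end Chains

/-! ### The calculus -/

/-- The last component of a state: `⊤`, `⊥` or a closure `C·σ`. -/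
inductive Status (L : FirstOrder.Language.{u, 0}) (V : Type v) : Type (max u v)
  | top : Status L V
  | bot : Status L V
  | conflict (C : Clause L V) (σ : Subst L V) : Status L V

/-- A state `(Γ; N; U; β; k; D)`. -/
structure State (L : FirstOrder.Language.{u, 0}) (V : Type v) where
  Γ : Trail L V
  N : Set (Clause L V)
  U : Set (Clause L V)
  β : L.Term V
  k : ℕ
  D : Status L V

section Calculus

variable {L : FirstOrder.Language.{u, 0}} {V : Type v} (prec : L.Term V → L.Term V → Prop)

/-- Some ground instance of `C` is `β`-false in `Γ, K` but not in `Γ`. -/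
def BecomesFalse (β : L.Term V) (C : Clause L V) (Γ : Trail L V) (K : AnnLit L V) : Prop :=
  ∃ τ : Subst L V, Grounding τ C ∧ ClauseBFalse prec β (lits (Γ ++ [K])) (clauseSubst C τ) ∧
    ¬ ClauseBFalse prec β (lits Γ) (clauseSubst C τ)

/-- The rules of the calculus. In `propagate`, the literals of `C₁` and the literal `K` are given as
equations `q.1 # q.2` and `s # t`, so that `μ` is a most general unifier of them all. In
`exploreRefutation`, the whole trail `Γ` of the state is used, and its last literal is the defining
literal of `K·σ`. -/
inductive Step : State L V → State L V → Prop
  | propagate {Γ : Trail L V} {N U : Set (Clause L V)} {β : L.Term V} {k : ℕ}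
      {C C₀ C₁ : Clause L V} {K : Lit L V} {σ μ : Subst L V} {b : Bool} {s t : L.Term V}
      {Q : Multiset (L.Term V × L.Term V)} {P : List (RewriteStep L V)} {I : RewriteStep L V} :
      C ∈ N ∪ U → Grounding σ C → C = C₀ + C₁ + {K} →
      ClauseFalse (lits Γ) (clauseSubst C₀ σ) →
      K = mkLit b s t → C₁ = Q.map (fun q => mkLit b q.1 q.2) →
      (∀ q ∈ Q, q.1.subst σ = s.subst σ ∧ q.2.subst σ = t.subst σ) →
      IsMGU μ {e | ∃ q ∈ Q, e = (q.1, s) ∨ e = (q.2, t)} →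
      LitBUndefined prec β (lits Γ) (K.subst σ) →
      clauseBelow prec (clauseSubst (clauseSubst (C₀ + {K}) μ) σ) β →
      IrreducibleSubst (conv prec (lits Γ)) σ →
      ReductionChainApplication prec Γ ⟨K.subst μ, clauseSubst C₀ μ, σ⟩ P →
      P.getLast? = some I →
      Step ⟨Γ, N, U, β, k, .top⟩ ⟨Γ ++ [⟨I.closure, k⟩], N, U, β, k, .top⟩
  | decide {Γ : Trail L V} {N U : Set (Clause L V)} {β : L.Term V} {k : ℕ}
      {C C₀ : Clause L V} {K : Lit L V} {σ : Subst L V}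
      {P : List (RewriteStep L V)} {I : RewriteStep L V} :
      C ∈ N ∪ U → Grounding σ C → C = C₀ + {K} →
      (ClauseBUndefined prec β (lits Γ) (clauseSubst C₀ σ) ∨
        ClauseBTrue prec β (lits Γ) (clauseSubst C₀ σ)) →
      LitBUndefined prec β (lits Γ) (K.subst σ) →
      clauseBelow prec (clauseSubst (C₀ + {K}) σ) β →
      IrreducibleSubst (conv prec (lits Γ)) σ →
      ReductionChainApplication prec Γ ⟨K, C₀, σ⟩ P →
      P.getLast? = some I →
      Step ⟨Γ, N, U, β, k, .top⟩
        ⟨Γ ++ [⟨⟨I.closure.lit, {I.closure.lit.comp}, I.closure.subst⟩, k + 1⟩],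
          N, U, β, k + 1, .top⟩
  | conflictBot {Γ : Trail L V} {N U : Set (Clause L V)} {β : L.Term V} {k : ℕ}
      {C : Clause L V} {σ : Subst L V} :
      C ∈ N ∪ U → Grounding σ C → ClauseBFalse prec β (lits Γ) (clauseSubst C σ) →
      IrreducibleSubst (conv prec (lits Γ)) σ → ClauseLevel Γ (clauseSubst C σ) 0 →
      Step ⟨Γ, N, U, β, k, .top⟩ ⟨Γ, N, U, β, k, .bot⟩
  | conflict {Γ : Trail L V} {N U : Set (Clause L V)} {β : L.Term V} {k : ℕ}
      {C : Clause L V} {σ : Subst L V} :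
      C ∈ N ∪ U → Grounding σ C → ClauseBFalse prec β (lits Γ) (clauseSubst C σ) →
      IrreducibleSubst (conv prec (lits Γ)) σ → ¬ ClauseLevel Γ (clauseSubst C σ) 0 →
      Step ⟨Γ, N, U, β, k, .top⟩ ⟨Γ, N, U, β, k, .conflict C σ⟩
  | skip {Γ : Trail L V} {N U : Set (Clause L V)} {β : L.Term V} {k : ℕ}
      {C : Clause L V} {σ : Subst L V} {e e' : AnnLit L V} :
      e'.level = k → ClauseBFalse prec β (lits (Γ ++ [e])) (clauseSubst C σ) →
      Step ⟨Γ ++ [e, e'], N, U, β, k, .conflict C σ⟩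
        ⟨Γ ++ [e], N, U, β, e.level, .conflict C σ⟩
  | exploreRefutation {Γ : Trail L V} {N U : Set (Clause L V)} {β : L.Term V} {k : ℕ}
      {C : Clause L V} {K : Lit L V} {σ : Subst L V} {i : Fin Γ.length}
      {P : List (RewriteStep L V)} {I : RewriteStep L V} :
      (∀ H ∈ clauseSubst C σ, H ≠ K.subst σ ∧ ¬ TrailPrec prec β Γ (K.subst σ) H) →
      i.val + 1 = Γ.length → IsDefining Γ (K.subst σ) i →
      Refutation prec β Γ ⟨K, C, σ⟩ P → I ∈ P →
      MulExt (TrailPrec prec β Γ) (clauseSubst I.closure.clause I.closure.subst)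
        (clauseSubst (C + {K}) σ) →
      ClauseBFalse prec β (lits Γ) (clauseSubst I.closure.clause I.closure.subst) →
      Step ⟨Γ, N, U, β, k, .conflict (C + {K}) σ⟩
        ⟨Γ, N, U, β, k, .conflict I.closure.clause I.closure.subst⟩
  | factorize {Γ : Trail L V} {N U : Set (Clause L V)} {β : L.Term V} {k : ℕ}
      {C : Clause L V} {σ μ : Subst L V} {b : Bool} {s t s' t' : L.Term V} :
      s.subst σ = s'.subst σ → t.subst σ = t'.subst σ → IsMGU μ {(s, s'), (t, t')} →
      Step ⟨Γ, N, U, β, k, .conflict (C + {mkLit b s t} + {mkLit b s' t'}) σ⟩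
        ⟨Γ, N, U, β, k, .conflict (clauseSubst (C + {mkLit b s t}) μ) σ⟩
  | equalityResolution {Γ : Trail L V} {N U : Set (Clause L V)} {β : L.Term V} {k : ℕ}
      {C : Clause L V} {σ μ : Subst L V} {s s' : L.Term V} :
      s.subst σ = s'.subst σ → IsMGU μ {(s, s')} →
      Step ⟨Γ, N, U, β, k, .conflict (C + {mkLit false s s'}) σ⟩
        ⟨Γ, N, U, β, k, .conflict (clauseSubst C μ) σ⟩
  | backtrack {Γ Γ' : Trail L V} {K : AnnLit L V} {N U : Set (Clause L V)} {β : L.Term V}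
      {k k' m : ℕ} {C : Clause L V} {H : Lit L V} {σ : Subst L V} :
      ClauseLevel (Γ ++ K :: Γ') (clauseSubst C σ) m → m < k →
      BecomesFalse prec β (C + {H}) Γ K →
      (∀ Γ₀ K₀ Γ₁, Γ ++ [K] = Γ₀ ++ K₀ :: Γ₁ → BecomesFalse prec β (C + {H}) Γ₀ K₀ → Γ₁ = []) →
      ((IsDecision Γ K ∧ k' + 1 = K.level) ∨ (¬ IsDecision Γ K ∧ k' = K.level)) →
      Step ⟨Γ ++ K :: Γ', N, U, β, k, .conflict (C + {H}) σ⟩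
        ⟨Γ, N, U ∪ {C + {H}}, β, k', .top⟩
  | grow {Γ : Trail L V} {N U : Set (Clause L V)} {β β' : L.Term V} {k : ℕ} :
      IsGround β' → prec β β' →
      Step ⟨Γ, N, U, β, k, .top⟩ ⟨[], N, U, β', 0, .top⟩

/-- The initial state `(ε; N; ∅; β; 0; ⊤)`. -/
def initialState (N : Set (Clause L V)) (β : L.Term V) : State L V := ⟨[], N, ∅, β, 0, .top⟩

/-- `S` results from a run, that is, from a finite sequence of rule applications starting in the
initial state. -/
def ResultsFromRun (N : Set (Clause L V)) (β : L.Term V) (S : State L V) : Prop :=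
  Relation.ReflTransGen (Step prec) (initialState N β) S

/-- Soundness of a state. -/
structure Sound (S : State L V) : Prop where
  consistent : Consistent (lits S.Γ)
  grounding : ∀ e ∈ S.Γ, Grounding e.closure.subst e.closure.clause
  propagated : ∀ Γ₁ e Γ₂, S.Γ = Γ₁ ++ e :: Γ₂ → ¬ IsDecision Γ₁ e →
    ClauseBFalse prec S.β (lits Γ₁) (clauseSubst e.closure.rest e.closure.subst) ∧
    LitBUndefined prec S.β (lits Γ₁) e.inst ∧
    e.inst.Irreducible (conv prec (lits Γ₁)) ∧
    Entails (S.N ∪ S.U) e.closure.clause ∧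
    clauseBelow prec (clauseSubst e.closure.clause e.closure.subst) S.β
  decision : ∀ Γ₁ e Γ₂, S.Γ = Γ₁ ++ e :: Γ₂ → IsDecision Γ₁ e →
    e.closure.rest = {e.closure.lit.comp} ∧
    LitBUndefined prec S.β (lits Γ₁) e.inst ∧
    e.inst.Irreducible (conv prec (lits Γ₁)) ∧
    Entails (S.N ∪ S.U) e.closure.clause ∧
    clauseBelow prec (clauseSubst e.closure.clause e.closure.subst) S.β
  learned : ∀ C ∈ S.U, Entails S.N C
  conflict : ∀ C σ, S.D = .conflict C σ →
    Grounding σ C ∧ ClauseBFalse prec S.β (lits S.Γ) (clauseSubst C σ) ∧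
    Entails (S.N ∪ S.U) C
  bot : S.D = .bot → Entails (S.N ∪ S.U) 0

end Calculus

end SCLEQ

namespace SCLEQ

open FirstOrder.Language

/-! ### Substitutions, subterm replacement and absorption of most general unifiers. -/

section TermLemmas

variable {L : FirstOrder.Language.{u, 0}} {V : Type v}

/-! Soundness is an invariant of single rule applications, but it is not inductive as stated and is
strengthened to `StateInvariant`. The additions are that trail literals are undefined outright
rather than only `β`-undefined, that `k` is the level of the last trail literal, and that each trail
entry is either a decision (one level up, paired with its complement) or stays at the current level
with the rest of its clause false.

Three facts carry the argument. First, an idempotent mgu is absorbed by every unifier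
(`IsMGU.comp_eq`), so factoring, equality resolution and rewrite inferences change the clause of a
closure but not the ground instances of the literals that survive. On ground instances, a rewrite
inference therefore replaces one subterm by a smaller one and unites the remaining literals
(`DisjointRewriteInference.rewritesInstance`); on clauses it is paramodulation, hence sound. By
induction along a reduction chain, groundness, entailment, the bound `β` and falsity of the
remaining literals pass from the available closures to all members of the chain.

Second, rewriting by `conv(Γ)` preserves truth in every model of `Γ`. A literal that is undefined
before normalization is thus undefined afterwards, and an undefined ground literal can be added
without losing consistency (`consistent_insert`).

Third, for Conflict at level `0`: levels never decrease along the trail, and a literal of level `0`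
must have been propagated from literals of level `0`, so it holds in all models of the clause set. A
false literal of level `0` has a core consisting of such literals, so its complement holds in these
models too. A false clause of level `0` therefore contradicts the clause set. -/

theorem subst_subst (t : L.Term V) (σ τ : Subst L V) :
    (t.subst σ).subst τ = t.subst (σ.comp τ) := by
  induction t with
  | var x => rfl
  | func f ts ih => simp [Term.subst, ih]

theorem subst_var (t : L.Term V) : t.subst (fun x => Term.var x) = t := by
  induction t with
  | var x => rfl
  | func f ts ih => simp [Term.subst, ih]

theorem mem_vars_func {n : ℕ} {f : L.Functions n} {ts : Fin n → L.Term V} {x : V} :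
    x ∈ vars (Term.func f ts) ↔ ∃ i, x ∈ vars (ts i) := by
  simp [vars]

theorem subst_congr {t : L.Term V} {σ τ : Subst L V} (h : ∀ x ∈ vars t, σ x = τ x) :
    t.subst σ = t.subst τ := by
  induction t with
  | var x => exact h x (by simp [vars])
  | func f ts ih =>
    simp only [Term.subst]
    congr 1
    funext i
    exact ih i fun x hx => h x (mem_vars_func.2 ⟨i, hx⟩)

/-- Converse of `subst_congr`. It turns the conditions on `δ` and `ρ` in an inference below a
variable, which are equations between terms, into equations between variable images. -/
theorem eq_on_vars_of_subst_eq {t : L.Term V} {σ τ : Subst L V} (h : t.subst σ = t.subst τ) :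
    ∀ x ∈ vars t, σ x = τ x := by
  induction t with
  | var y =>
    intro x hx
    obtain rfl : x = y := by simpa [vars] using hx
    exact h
  | func f ts ih =>
    intro x hx
    obtain ⟨i, hi⟩ := mem_vars_func.1 hx
    simp only [Term.subst, Term.func.injEq, heq_eq_eq, true_and] at h
    exact ih i (congrFun h i) x hi

theorem IsGround.subst_eq {t : L.Term V} (h : IsGround t) (σ : Subst L V) : t.subst σ = t := by
  conv_rhs => rw [← subst_var t]
  refine subst_congr fun x hx => ?_
  rw [IsGround] at h
  simp [h] at hx

theorem mem_vars_subst {t : L.Term V} {σ : Subst L V} {y : V} :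
    y ∈ vars (t.subst σ) ↔ ∃ x ∈ vars t, y ∈ vars (σ x) := by
  induction t with
  | var x => simp [vars, Term.subst]
  | func f ts ih =>
    simp only [Term.subst, mem_vars_func, ih]
    constructor
    · rintro ⟨i, x, hx, hy⟩
      exact ⟨x, ⟨i, hx⟩, hy⟩
    · rintro ⟨x, ⟨i, hx⟩, hy⟩
      exact ⟨i, x, hx, hy⟩

theorem isGround_subst {t : L.Term V} {σ : Subst L V} :
    IsGround (t.subst σ) ↔ ∀ x ∈ vars t, IsGround (σ x) := by
  simp only [IsGround, Set.eq_empty_iff_forall_notMem, mem_vars_subst]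
  constructor
  · intro h x hx y hy
    exact h y ⟨x, hx, hy⟩
  · rintro h y ⟨x, hx, hy⟩
    exact h x hx y hy

theorem subtermAt_subst {p : List ℕ} {t s : L.Term V} (h : subtermAt p t = some s)
    (σ : Subst L V) : subtermAt p (t.subst σ) = some (s.subst σ) := by
  induction p generalizing t with
  | nil => simp_all [subtermAt]
  | cons i p ih =>
    cases t with
    | var x => simp [subtermAt] at h
    | func f ts =>
      simp only [subtermAt, Term.subst] at h ⊢
      split_ifs at h ⊢ with hi
      exact ih h

theorem replaceAt_subst {p : List ℕ} {t s r : L.Term V} (h : subtermAt p t = some s)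
    (σ : Subst L V) :
    (replaceAt p r t).subst σ = replaceAt p (r.subst σ) (t.subst σ) := by
  induction p generalizing t with
  | nil => simp [replaceAt]
  | cons i p ih =>
    cases t with
    | var x => simp [subtermAt] at h
    | func f ts =>
      simp only [subtermAt] at h
      split_ifs at h with hi
      simp only [replaceAt, Term.subst, hi, dif_pos]
      congr 1
      funext j
      by_cases hj : j = ⟨i, hi⟩
      · subst hj
        simpa using ih h
      · simp [Function.update_of_ne hj]

theorem isGround_replaceAt {p : List ℕ} {t r : L.Term V} (ht : IsGround t) (hr : IsGround r) :
    IsGround (replaceAt p r t) := by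
  induction p generalizing t with
  | nil => simpa [replaceAt] using hr
  | cons i p ih =>
    cases t with
    | var x => simpa [replaceAt] using ht
    | func f ts =>
      have hts : ∀ j, IsGround (ts j) := by
        intro j
        rw [IsGround, Set.eq_empty_iff_forall_notMem] at ht ⊢
        exact fun x hx => ht x (mem_vars_func.2 ⟨j, hx⟩)
      simp only [replaceAt]
      split_ifs with hi
      · rw [IsGround, Set.eq_empty_iff_forall_notMem]
        intro x hx
        obtain ⟨j, hj⟩ := mem_vars_func.1 hx
        by_cases hji : j = ⟨i, hi⟩
        · subst hji
          rw [Function.update_self] at hj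
          have := ih (hts ⟨i, hi⟩)
          rw [IsGround] at this
          simp [this] at hj
        · rw [Function.update_of_ne hji] at hj
          have := hts j
          rw [IsGround] at this
          simp [this] at hj
      · exact ht

/-- Closure under contexts, applied once for each symbol on the path `p`. This keeps conclusions of
rewrite inferences below `β`. -/
theorem IsDesired.replaceAt {prec : L.Term V → L.Term V → Prop} (hprec : IsDesired prec)
    {p : List ℕ} {t s r : L.Term V} (h : subtermAt p t = some s) (hrs : prec r s) :
    prec (replaceAt p r t) t := by
  induction p generalizing t with
  | nil =>
    obtain rfl : t = s := by simpa [subtermAt] using h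
    exact hrs
  | cons i p ih =>
    cases t with
    | var x => simp [subtermAt] at h
    | func f ts =>
      simp only [subtermAt] at h
      split_ifs at h with hi
      simp only [SCLEQ.replaceAt, hi, dif_pos]
      simpa using hprec.context f ts ⟨i, hi⟩ _ _ (ih h)

theorem realize_replaceAt {M : Type*} [L.Structure M] {a : V → M} {p : List ℕ} {t s r : L.Term V}
    (h : subtermAt p t = some s) (hrs : r.realize a = s.realize a) :
    (replaceAt p r t).realize a = t.realize a := by
  induction p generalizing t with
  | nil =>
    obtain rfl : t = s := by simpa [subtermAt] using h
    exact hrs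
  | cons i p ih =>
    cases t with
    | var x => simp [subtermAt] at h
    | func f ts =>
      simp only [subtermAt] at h
      split_ifs at h with hi
      simp only [replaceAt, hi, dif_pos, Term.realize_func]
      congr 1
      funext j
      by_cases hj : j = ⟨i, hi⟩
      · subst hj
        simpa using ih h
      · simp [Function.update_of_ne hj]

theorem IsGround.realize_eq {M : Type*} [L.Structure M] {t : L.Term V} (h : IsGround t)
    (a b : V → M) : t.realize a = t.realize b := by
  induction t with
  | var x => simp [IsGround, vars] at h
  | func f ts ih =>
    simp only [Term.realize_func]
    congr 1
    funext i
    refine ih i ?_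
    rw [IsGround, Set.eq_empty_iff_forall_notMem] at h ⊢
    exact fun x hx => h x (mem_vars_func.2 ⟨i, hx⟩)

/-- Writing `τ = μρ`, idempotence gives `μτ = μμρ = μρ = τ`. Consequently a closure may keep its
grounding substitution after its clause has been instantiated by `μ`. -/
theorem IsMGU.comp_eq {μ τ : Subst L V} {E : Set (L.Term V × L.Term V)} (h : IsMGU μ E)
    (hτ : Unifies τ E) : μ.comp τ = τ := by
  obtain ⟨ρ, rfl⟩ := h.most_general τ hτ
  have : μ.comp (μ.comp ρ) = (μ.comp μ).comp ρ := by
    funext x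
    simp [Subst.comp, subst_subst]
  rw [this, h.idempotent]

end TermLemmas

/-! ### Literals and clauses under substitution. -/

section LitLemmas

variable {L : FirstOrder.Language.{u, 0}} {V : Type v}

theorem Lit.eq_mkLit (K : Lit L V) : ∃ s t, K = mkLit K.pos s t := by
  obtain ⟨b, e⟩ := K
  induction e with
  | _ s t => exact ⟨s, t, rfl⟩

theorem mkLit_subst (b : Bool) (s t : L.Term V) (σ : Subst L V) :
    (mkLit b s t).subst σ = mkLit b (s.subst σ) (t.subst σ) := rfl

theorem Lit.comp_subst (K : Lit L V) (σ : Subst L V) : K.comp.subst σ = (K.subst σ).comp := rfl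

theorem Lit.comp_comp (K : Lit L V) : K.comp.comp = K := by
  cases K
  simp [Lit.comp]

theorem Lit.subst_subst (K : Lit L V) (σ τ : Subst L V) :
    (K.subst σ).subst τ = K.subst (σ.comp τ) := by
  obtain ⟨s, t, h⟩ := K.eq_mkLit
  rw [h]
  simp [mkLit_subst, SCLEQ.subst_subst]

theorem mem_mkLit_vars {b : Bool} {s t : L.Term V} {x : V} :
    x ∈ (mkLit b s t).vars ↔ x ∈ vars s ∨ x ∈ vars t := by
  simp [mkLit, Lit.vars]

theorem isGround_mkLit {b : Bool} {s t : L.Term V} :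
    (mkLit b s t).IsGround ↔ IsGround s ∧ IsGround t := by
  simp [mkLit, Lit.IsGround]

theorem Lit.isGround_comp {K : Lit L V} : K.comp.IsGround ↔ K.IsGround := Iff.rfl

theorem Lit.subst_congr {K : Lit L V} {σ τ : Subst L V} (h : ∀ x ∈ K.vars, σ x = τ x) :
    K.subst σ = K.subst τ := by
  obtain ⟨s, t, hK⟩ := K.eq_mkLit
  rw [hK] at h ⊢
  simp only [mkLit_subst]
  rw [SCLEQ.subst_congr fun x hx => h x (mem_mkLit_vars.2 (Or.inl hx)),
    SCLEQ.subst_congr fun x hx => h x (mem_mkLit_vars.2 (Or.inr hx))]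

theorem Lit.isGround_subst {K : Lit L V} {σ : Subst L V} :
    (K.subst σ).IsGround ↔ ∀ x ∈ K.vars, SCLEQ.IsGround (σ x) := by
  obtain ⟨s, t, hK⟩ := K.eq_mkLit
  rw [hK]
  simp only [mkLit_subst, isGround_mkLit, SCLEQ.isGround_subst, mem_mkLit_vars]
  constructor
  · rintro ⟨h, h'⟩ x (hx | hx)
    exacts [h x hx, h' x hx]
  · exact fun h => ⟨fun x hx => h x (Or.inl hx), fun x hx => h x (Or.inr hx)⟩

theorem clauseSubst_clauseSubst (C : Clause L V) (σ τ : Subst L V) :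
    clauseSubst (clauseSubst C σ) τ = clauseSubst C (σ.comp τ) := by
  simp [clauseSubst, Multiset.map_map, Lit.subst_subst]

theorem clauseSubst_add (C D : Clause L V) (σ : Subst L V) :
    clauseSubst (C + D) σ = clauseSubst C σ + clauseSubst D σ := Multiset.map_add _ _ _

theorem clauseSubst_congr {C : Clause L V} {σ τ : Subst L V} (h : ∀ x ∈ clauseVars C, σ x = τ x) :
    clauseSubst C σ = clauseSubst C τ :=
  Multiset.map_congr rfl fun K hK => Lit.subst_congr fun x hx => h x ⟨K, hK, hx⟩

theorem mem_clauseSubst {C : Clause L V} {σ : Subst L V} {H : Lit L V} :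
    H ∈ clauseSubst C σ ↔ ∃ K ∈ C, K.subst σ = H := Multiset.mem_map

theorem grounding_iff {C : Clause L V} {σ : Subst L V} :
    Grounding σ C ↔ ∀ x ∈ clauseVars C, IsGround (σ x) := by
  constructor
  · rintro h x ⟨K, hK, hx⟩
    exact Lit.isGround_subst.1 (h _ (mem_clauseSubst.2 ⟨K, hK, rfl⟩)) x hx
  · intro h H hH
    obtain ⟨K, hK, rfl⟩ := mem_clauseSubst.1 hH
    exact Lit.isGround_subst.2 fun x hx => h x ⟨K, hK, hx⟩

/-! ### Comparison of literals and clauses with the bound `β`. -/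

section Ordering

variable {prec : L.Term V → L.Term V → Prop}

/-- The only nonempty submultiset that can be removed from `{b}` is `{b}` itself. Hence being below
`β` is a condition on each term separately. -/
theorem mulExt_singleton {α : Type*} {r : α → α → Prop} {M : Multiset α} {b : α} :
    MulExt r M {b} ↔ ∀ y ∈ M, r y b := by
  constructor
  · rintro ⟨X, Y, Z, hZ, rfl, hb, h⟩
    obtain ⟨z, hz⟩ := Multiset.exists_mem_of_ne_zero hZ
    have hc := congrArg Multiset.card hb
    have hZc := Multiset.card_pos.2 hZ
    simp only [Multiset.card_singleton, Multiset.card_add] at hc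
    have hX : X = 0 := Multiset.card_eq_zero.1 (by omega)
    subst hX
    rw [zero_add] at hb
    subst hb
    simpa using h
  · intro h
    exact ⟨0, M, {b}, by simp, by simp, by simp, fun y hy => ⟨b, by simp, h y hy⟩⟩

theorem Lit.mem_toMS {K : Lit L V} {t : L.Term V} : t ∈ K.toMS ↔ t ∈ K.atom := by
  unfold Lit.toMS
  split_ifs <;> simp

theorem litBelow_iff {K : Lit L V} {β : L.Term V} :
    litBelow prec K β ↔ ∀ t ∈ K.atom, prec t β := by
  simp [litBelow, mulExt_singleton, Lit.mem_toMS]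

theorem clauseBelow_iff {C : Clause L V} {β : L.Term V} :
    clauseBelow prec C β ↔ ∀ K ∈ C, litBelow prec K β := by
  simp [clauseBelow, mulExt_singleton, litBelow]

theorem litBelow_mkLit {b : Bool} {s t β : L.Term V} :
    litBelow prec (mkLit b s t) β ↔ prec s β ∧ prec t β := by
  simp [litBelow_iff, mkLit]

theorem litBelow_comp {K : Lit L V} {β : L.Term V} :
    litBelow prec K.comp β ↔ litBelow prec K β := by
  simp [litBelow_iff, Lit.comp]

/-- A literal cannot lie both above and below `β`: either `β` would be one of its terms, or some
term of it would exceed `β`, while all its terms are below `β`. So only genuine undefinedness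
remains. -/
theorem IsDesired.litUndefined (hprec : IsDesired prec) {β : L.Term V} {G : Set (Lit L V)}
    {K : Lit L V} (h : LitBUndefined prec β G K) (hK : litBelow prec K β) : LitUndefined G K := by
  refine h.resolve_left ?_
  rw [litBelow_iff] at hK
  rintro ⟨X, Y, Z, -, hβ, hM, hY⟩
  have hmem : β ∈ X + Y := by rw [← hβ]; simp
  rcases Multiset.mem_add.1 hmem with hX | hY'
  · exact hprec.irrefl β (hK β (Lit.mem_toMS.1 (hM ▸ Multiset.mem_add.2 (Or.inl hX))))
  · obtain ⟨z, hz, hlt⟩ := hY β hY'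
    have := hK z (Lit.mem_toMS.1 (hM ▸ Multiset.mem_add.2 (Or.inr hz)))
    exact hprec.irrefl β (hprec.trans _ _ _ hlt this)

end Ordering

/-! ### Models, entailment and consistency. -/

section Semantics

variable {M : Type*} [L.Structure M]

theorem holds_mkLit {b : Bool} {s t : L.Term V} {a : V → M} :
    (mkLit b s t).Holds a ↔ (b = true ↔ s.realize a = t.realize a) := by
  cases b <;> simp [Lit.Holds, mkLit]

theorem Lit.holds_comp {K : Lit L V} {a : V → M} : K.comp.Holds a ↔ ¬ K.Holds a := by
  obtain ⟨b, e⟩ := K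
  cases b <;> simp [Lit.Holds, Lit.comp]

theorem Lit.holds_subst {K : Lit L V} {σ : Subst L V} {a : V → M} :
    (K.subst σ).Holds a ↔ K.Holds fun x => (σ x).realize a := by
  obtain ⟨s, t, h⟩ := K.eq_mkLit
  rw [h, mkLit_subst, holds_mkLit, holds_mkLit]
  simp

theorem Lit.IsGround.holds_congr {K : Lit L V} (hK : K.IsGround) (a b : V → M) :
    K.Holds a ↔ K.Holds b := by
  obtain ⟨s, t, h⟩ := K.eq_mkLit
  rw [h] at hK ⊢
  obtain ⟨hs, ht⟩ := isGround_mkLit.1 hK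
  rw [holds_mkLit, holds_mkLit, hs.realize_eq a b, ht.realize_eq a b]

theorem modelsClause_singleton {K : Lit L V} :
    ModelsClause M ({K} : Clause L V) ↔ ∀ a : V → M, K.Holds a := by
  simp [ModelsClause]

theorem ModelsClause.clauseSubst {C : Clause L V} (h : ModelsClause M C) (σ : Subst L V) :
    ModelsClause M (clauseSubst C σ) := by
  intro a
  obtain ⟨K, hK, hh⟩ := h fun x => (σ x).realize a
  exact ⟨_, mem_clauseSubst.2 ⟨K, hK, rfl⟩, Lit.holds_subst.2 hh⟩

theorem ModelsClause.mono {C D : Clause L V} (h : ModelsClause M C) (hCD : C ⊆ D) :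
    ModelsClause M D := fun a =>
  let ⟨K, hK, hh⟩ := h a
  ⟨K, hCD hK, hh⟩

/-- `M` is a model of all literals in `G`. -/
def ModelsLits (M : Type*) [L.Structure M] (G : Set (Lit L V)) : Prop :=
  ∀ K ∈ G, ∀ a : V → M, K.Holds a

theorem consistent_iff {G : Set (Lit L V)} :
    Consistent G ↔ ∃ (M : Type u) (_ : L.Structure M) (_ : Nonempty M), ModelsLits M G := by
  simp only [Consistent, modelsClause_singleton, ModelsLits]

theorem litEntails_iff {G : Set (Lit L V)} {K : Lit L V} :
    LitEntails G K ↔ ∀ (M : Type u) [L.Structure M] [Nonempty M], ModelsLits M G →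
      ∀ a : V → M, K.Holds a := by
  simp only [LitEntails, Entails, Set.forall_mem_image, modelsClause_singleton, ModelsLits]

theorem ModelsLits.mono {G G' : Set (Lit L V)} (h : ModelsLits M G') (hG : G ⊆ G') :
    ModelsLits M G := fun K hK => h K (hG hK)

theorem LitEntails.mono {G G' : Set (Lit L V)} {K : Lit L V} (h : LitEntails G K) (hG : G ⊆ G') :
    LitEntails G' K := by
  rw [litEntails_iff] at h ⊢
  intro M _ _ hM
  exact h M (hM.mono hG)

theorem litEntails_of_mem {G : Set (Lit L V)} {K : Lit L V} (h : K ∈ G) : LitEntails G K :=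
  litEntails_iff.2 fun _ _ _ hM => hM K h

theorem Consistent.not_true_false {G : Set (Lit L V)} (hG : Consistent G) {K : Lit L V}
    (ht : LitTrue G K) (hf : LitFalse G K) : False := by
  obtain ⟨M, _, _, hM⟩ := consistent_iff.1 hG
  obtain ⟨x⟩ := ‹Nonempty M›
  exact Lit.holds_comp.1 (litEntails_iff.1 hf M hM fun _ => x)
    (litEntails_iff.1 ht M hM fun _ => x)

theorem Entails.mono {N N' : Set (Clause L V)} {C : Clause L V} (h : Entails N C) (hN : N ⊆ N') :
    Entails N' C := fun M _ _ hM => h M fun C' hC' => hM C' (hN hC')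

theorem entails_of_mem {N : Set (Clause L V)} {C : Clause L V} (h : C ∈ N) : Entails N C :=
  fun _ _ _ hM => hM C h

theorem Entails.clauseSubst {N : Set (Clause L V)} {C : Clause L V} (h : Entails N C)
    (σ : Subst L V) : Entails N (clauseSubst C σ) :=
  fun M _ _ hM => (h M hM).clauseSubst σ

theorem Entails.subset {N : Set (Clause L V)} {C D : Clause L V} (h : Entails N C)
    (hCD : C ⊆ D) : Entails N D :=
  fun M _ _ hM => (h M hM).mono hCD

/-- Lets Backtrack learn a clause derived with the help of earlier learned clauses. -/
theorem Entails.trans {N U : Set (Clause L V)} {C : Clause L V} (h : Entails (N ∪ U) C)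
    (hU : ∀ D ∈ U, Entails N D) : Entails N C := by
  intro M _ _ hM
  refine h M fun D hD => ?_
  rcases hD with hD | hD
  exacts [hM D hD, hU D hD M hM]

theorem entails_lit_comp (N : Set (Clause L V)) (K : Lit L V) : Entails N (K ::ₘ {K.comp}) := by
  intro M _ _ _ a
  by_cases h : K.Holds a
  · exact ⟨K, by simp, h⟩
  · exact ⟨K.comp, by simp, Lit.holds_comp.2 h⟩

theorem litUndefined_congr {G : Set (Lit L V)} {K H : Lit L V}
    (h : ∀ (M : Type u) [L.Structure M] [Nonempty M], ModelsLits M G →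
      ∀ a : V → M, K.Holds a ↔ H.Holds a) : LitUndefined G K ↔ LitUndefined G H := by
  simp only [LitUndefined, LitDefined, LitTrue, LitFalse, litEntails_iff, Lit.holds_comp]
  refine not_congr (or_congr ?_ ?_) <;>
  · refine forall_congr' fun M => forall_congr' fun _ => forall_congr' fun _ =>
      forall_congr' fun hM => forall_congr' fun a => ?_
    rw [h M hM a]

/-- As the complement of `K` is not entailed, some model of `G` satisfies `K` under one assignment,
and then under all assignments because `K` is ground. -/
theorem consistent_insert {G : Set (Lit L V)} {K : Lit L V} (hK : K.IsGround)
    (h : LitUndefined G K) : Consistent (insert K G) := by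
  have hf : ¬ LitEntails G K.comp := fun hf => h (Or.inr hf)
  simp only [litEntails_iff, Lit.holds_comp] at hf
  push Not at hf
  obtain ⟨M, _, _, hM, a, ha⟩ := hf
  refine consistent_iff.2 ⟨M, ‹_›, ‹_›, ?_⟩
  rintro H (rfl | hH) b
  exacts [(hK.holds_congr a b).1 ha, hM H hH b]

end Semantics

/-! ### Rewriting by `conv` preserves truth. -/

section Rewriting

variable {prec : L.Term V → L.Term V → Prop}

theorem realize_eq_of_rewrites {M : Type u} [L.Structure M] [Nonempty M] {G : Set (Lit L V)}
    (hM : ModelsLits M G) {s t : L.Term V}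
    (h : Relation.ReflTransGen (Rewrites (conv prec G)) s t) (a : V → M) :
    s.realize a = t.realize a := by
  induction h with
  | refl => rfl
  | tail _ hstep ih =>
    obtain ⟨⟨l, r⟩, ⟨-, -, -, hent⟩, p, σ, hp, rfl⟩ := hstep
    rw [ih]
    symm
    refine realize_replaceAt hp ?_
    have := litEntails_iff.1 hent M (hM.mono (Set.sep_subset _ _)) fun x => (σ x).realize a
    rw [holds_mkLit] at this
    simpa using (this.1 rfl).symm

theorem LitNormalForm.holds_iff {M : Type u} [L.Structure M] [Nonempty M] {G : Set (Lit L V)}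
    (hM : ModelsLits M G) {K H : Lit L V} (h : LitNormalForm (conv prec G) K H) (a : V → M) :
    K.Holds a ↔ H.Holds a := by
  obtain ⟨s, t, s', t', hK, hH, hs, ht⟩ := h
  rw [hK, hH, holds_mkLit, holds_mkLit, realize_eq_of_rewrites hM hs.1,
    realize_eq_of_rewrites hM ht.1]

theorem LitNormalForm.irreducible {R : TRS L V} {K H : Lit L V} (h : LitNormalForm R K H) :
    H.Irreducible R := by
  obtain ⟨s, t, s', t', hK, hH, hs, ht⟩ := h
  rw [hH]
  intro r hr
  rcases Sym2.mem_iff.1 hr with rfl | rfl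
  exacts [hs.2, ht.2]

end Rewriting

end LitLemmas

/-! ### Rewrite inferences and induction along reduction chains. -/

section Inferences

variable {L : FirstOrder.Language.{u, 0}} {V : Type v}

theorem LitClosure.clauseSubst_clause (c : LitClosure L V) :
    clauseSubst c.clause c.subst = c.inst ::ₘ clauseSubst c.rest c.subst :=
  Multiset.map_cons _ _ _

theorem LitClosure.rename_comp (c : LitClosure L V) (ρ : Equiv.Perm V) :
    Subst.comp (fun x => Term.var (ρ x)) (c.rename ρ).subst = c.subst := by
  funext x
  simp [Subst.comp, LitClosure.rename, Term.subst]

theorem LitClosure.rename_inst (c : LitClosure L V) (ρ : Equiv.Perm V) :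
    (c.rename ρ).inst = c.inst := by
  have h := c.rename_comp ρ
  change (c.lit.subst _).subst _ = _
  rw [Lit.subst_subst, h]
  rfl

theorem LitClosure.rename_rest (c : LitClosure L V) (ρ : Equiv.Perm V) :
    clauseSubst (c.rename ρ).rest (c.rename ρ).subst = clauseSubst c.rest c.subst := by
  have h := c.rename_comp ρ
  change clauseSubst (clauseSubst c.rest _) _ = _
  rw [clauseSubst_clauseSubst, h]

theorem LitClosure.rename_clause (c : LitClosure L V) (ρ : Equiv.Perm V) :
    (c.rename ρ).clause = clauseSubst c.clause (fun x => .var (ρ x)) :=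
  (Multiset.map_cons _ _ _).symm

theorem LitClosure.grounding_rename {c : LitClosure L V} {ρ : Equiv.Perm V}
    (h : Grounding c.subst c.clause) :
    Grounding (c.rename ρ).subst (c.rename ρ).clause := by
  unfold Grounding at *
  rw [LitClosure.clauseSubst_clause] at *
  rwa [LitClosure.rename_inst, LitClosure.rename_rest]

variable {prec : L.Term V → L.Term V → Prop}

/-- The ground instance of the conclusion of a rewrite inference arises from those of the
premises by rewriting a subterm. -/
structure RewritesInstance (prec : L.Term V → L.Term V → Prop) (c₁ c₂ : LitClosure L V)
    (p : List ℕ) (out : LitClosure L V) : Prop where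
  lit : ∃ b l₁ r₁ l₂ r₂, c₁.inst = mkLit true l₁ r₁ ∧ c₂.inst = mkLit b l₂ r₂ ∧ prec r₁ l₁ ∧
    subtermAt p l₂ = some l₁ ∧ out.inst = mkLit b (replaceAt p r₁ l₂) r₂
  rest : clauseSubst out.rest out.subst =
    clauseSubst c₁.rest c₁.subst + clauseSubst c₂.rest c₂.subst

theorem mem_clauseVars_cons {K : Lit L V} {C : Clause L V} {x : V} :
    x ∈ clauseVars (K ::ₘ C) ↔ x ∈ K.vars ∨ x ∈ clauseVars C := by
  simp [clauseVars]

/-- The composed substitution `τ = σ₁σ₂ρ` acts as `σ₁` on the first premise, and `δτ` acts as `σ₂`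
on the second. Hence `τ` unifies the overlapped terms and absorbs `μ`. -/
theorem DisjointRewriteInference.rewritesInstance {c₁ c₂ out : LitClosure L V} {p : List ℕ}
    (h : DisjointRewriteInference prec c₁ c₂ p out)
    (h₁ : Grounding c₁.subst c₁.clause) (h₂ : Grounding c₂.subst c₂.clause) :
    RewritesInstance prec c₁ c₂ p out := by
  obtain ⟨b, l₁, r₁, l₂, r₂, s, δ, ρ, μ, hc₁, hc₂, hdisj, hlt, hp, hδ, hs, hμ, hlit, hrest,
    hsubst⟩ := h
  have g₁ := grounding_iff.1 h₁
  have g₂ := grounding_iff.1 h₂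
  -- The part of the side conditions common to both alternatives; for `δ` and `ρ` the identity it is
  -- trivial.
  have facts : (∀ x ∈ δ.dom, x ∈ vars l₂ ∪ vars r₂ ∧ Disjoint (vars (δ x)) c₁.vars) ∧
      ((l₂.subst δ).subst (c₂.subst.restrict c₂.vars)).subst ρ =
        l₂.subst (c₂.subst.restrict c₂.vars) ∧
      ((r₂.subst δ).subst (c₂.subst.restrict c₂.vars)).subst ρ =
        r₂.subst (c₂.subst.restrict c₂.vars) := by
    rcases hδ with ⟨-, rfl, rfl⟩ | ⟨-, hd, hfresh, ⟨-, hl, hr⟩, -, -⟩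
    · simp [Subst.dom, subst_var]
    · exact ⟨fun x hx => ⟨hd hx, (Set.disjoint_union_right.1 (hfresh x hx)).1⟩, hl, hr⟩
  obtain ⟨hdom, hl, hr⟩ := facts
  set σ₁ := c₁.subst.restrict c₁.vars with hσ₁
  set σ₂ := c₂.subst.restrict c₂.vars with hσ₂
  set τ := (σ₁.comp σ₂).comp ρ with hτ
  have hl₁v : ∀ x, x ∈ vars l₁ ∨ x ∈ vars r₁ → x ∈ c₁.vars := fun x hx =>
    mem_clauseVars_cons.2 (Or.inl (by rw [hc₁]; exact mem_mkLit_vars.2 hx))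
  have hl₂v : ∀ x, x ∈ vars l₂ ∨ x ∈ vars r₂ → x ∈ c₂.vars := fun x hx =>
    mem_clauseVars_cons.2 (Or.inl (by rw [hc₂]; exact mem_mkLit_vars.2 hx))
  -- The image under `σ₁` is ground, so `σ₂` and `ρ` leave it alone.
  have e₁ : ∀ x ∈ c₁.vars, τ x = c₁.subst x := by
    intro x hx
    have hg : IsGround (c₁.subst x) := g₁ x hx
    have : σ₁ x = c₁.subst x := by simp [hσ₁, Subst.restrict, hx]
    simp [hτ, Subst.comp, this, hg.subst_eq]
  have e₂ : ∀ x ∈ c₂.vars, σ₂ x = c₂.subst x := fun x hx => by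
    simp [hσ₂, Subst.restrict, hx]
  have efresh : ∀ t : L.Term V, Disjoint (vars t) c₁.vars → t.subst τ = (t.subst σ₂).subst ρ := by
    intro t ht
    rw [subst_subst]
    refine subst_congr fun x hx => ?_
    have : σ₁ x = .var x := by
      simp [hσ₁, Subst.restrict, Set.disjoint_left.1 ht hx]
    simp [hτ, Subst.comp, this, Term.subst]
  -- A variable moved by `δ` occurs in `l₂` or `r₂`, so the defining equations of `ρ` determine its
  -- image. Any other variable is mapped by `σ₂` to a ground term, and variable disjointness keeps
  -- `σ₁` from acting on it.
  have eδ : ∀ x ∈ c₂.vars, δ.comp τ x = c₂.subst x := by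
    intro x hx
    by_cases hxd : x ∈ δ.dom
    · obtain ⟨hxv, hxf⟩ := hdom x hxd
      change (δ x).subst τ = _
      rw [efresh _ hxf, ← e₂ x hx]
      rw [subst_subst, subst_subst] at hl hr
      rw [subst_subst]
      rcases hxv with hxv | hxv
      · simpa [Subst.comp, subst_subst] using eq_on_vars_of_subst_eq hl x hxv
      · simpa [Subst.comp, subst_subst] using eq_on_vars_of_subst_eq hr x hxv
    · have hxe : δ x = .var x := by simpa [Subst.dom] using hxd
      change (δ x).subst τ = _
      have hd : Disjoint (vars (δ x)) c₁.vars := by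
        rw [hxe]
        simpa [vars] using Set.disjoint_right.1 hdisj hx
      have hg : IsGround (c₂.subst x) := g₂ x hx
      rw [efresh _ hd, hxe]
      simp [Term.subst, e₂ x hx, hg.subst_eq]
  have el₁ : l₁.subst τ = l₁.subst c₁.subst :=
    subst_congr fun x hx => e₁ x (hl₁v x (Or.inl hx))
  have er₁ : r₁.subst τ = r₁.subst c₁.subst :=
    subst_congr fun x hx => e₁ x (hl₁v x (Or.inr hx))
  have el₂ : (l₂.subst δ).subst τ = l₂.subst c₂.subst := by
    rw [subst_subst]
    exact subst_congr fun x hx => eδ x (hl₂v x (Or.inl hx))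
  have er₂ : (r₂.subst δ).subst τ = r₂.subst c₂.subst := by
    rw [subst_subst]
    exact subst_congr fun x hx => eδ x (hl₂v x (Or.inr hx))
  -- `τ` unifies `s` and `l₁`, since both become the subterm at `p` of the ground instance of `l₂`.
  have hμτ : μ.comp τ = τ := by
    refine hμ.comp_eq ?_
    rintro e rfl
    have := subtermAt_subst hs τ
    rw [el₂, hp] at this
    rw [el₁]
    exact (Option.some.inj this).symm
  refine ⟨⟨b, l₁.subst c₁.subst, r₁.subst c₁.subst, l₂.subst c₂.subst, r₂.subst c₂.subst,
    ?_, ?_, hlt, hp, ?_⟩, ?_⟩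
  · rw [LitClosure.inst, hc₁, mkLit_subst]
  · rw [LitClosure.inst, hc₂, mkLit_subst]
  · rw [LitClosure.inst, hlit, hsubst, mkLit_subst, subst_subst, subst_subst, hμτ,
      replaceAt_subst hs, el₂, er₂, er₁]
  · rw [hrest, hsubst, clauseSubst_add, clauseSubst_clauseSubst, clauseSubst_clauseSubst, hμτ,
      clauseSubst_clauseSubst]
    congr 1
    · exact clauseSubst_congr fun x hx => e₁ x (mem_clauseVars_cons.2 (Or.inr hx))
    · exact clauseSubst_congr fun x hx => eδ x (mem_clauseVars_cons.2 (Or.inr hx))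

theorem RewriteInference.rewritesInstance {c₁ c₂ out : LitClosure L V} {p : List ℕ}
    (h : RewriteInference prec c₁ c₂ p out)
    (h₁ : Grounding c₁.subst c₁.clause) (h₂ : Grounding c₂.subst c₂.clause) :
    RewritesInstance prec c₁ c₂ p out := by
  obtain ⟨ρ₁, ρ₂, h⟩ := h
  obtain ⟨hlit, hrest⟩ := h.rewritesInstance (LitClosure.grounding_rename h₁)
    (LitClosure.grounding_rename h₂)
  simp only [LitClosure.rename_inst, LitClosure.rename_rest] at hlit hrest
  exact ⟨hlit, hrest⟩

theorem RewriteInference.grounding {c₁ c₂ out : LitClosure L V} {p : List ℕ}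
    (h : RewriteInference prec c₁ c₂ p out)
    (h₁ : Grounding c₁.subst c₁.clause) (h₂ : Grounding c₂.subst c₂.clause) :
    Grounding out.subst out.clause := by
  obtain ⟨⟨b, l₁, r₁, l₂, r₂, e₁, e₂, -, -, eo⟩, hrest⟩ := h.rewritesInstance h₁ h₂
  unfold Grounding at *
  rw [LitClosure.clauseSubst_clause] at *
  rw [e₁] at h₁
  rw [e₂] at h₂
  rw [eo, hrest]
  have hg₁ := isGround_mkLit.1 (h₁ _ (Multiset.mem_cons_self _ _))
  have hg₂ := isGround_mkLit.1 (h₂ _ (Multiset.mem_cons_self _ _))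
  intro K hK
  rcases Multiset.mem_cons.1 hK with rfl | hK
  · exact isGround_mkLit.2 ⟨isGround_replaceAt hg₂.1 hg₁.2, hg₂.2⟩
  · rcases Multiset.mem_add.1 hK with hK | hK
    exacts [h₁ _ (Multiset.mem_cons_of_mem hK), h₂ _ (Multiset.mem_cons_of_mem hK)]

theorem RewriteInference.clauseBelow (hprec : IsDesired prec) {β : L.Term V}
    {c₁ c₂ out : LitClosure L V} {p : List ℕ} (h : RewriteInference prec c₁ c₂ p out)
    (h₁ : Grounding c₁.subst c₁.clause) (h₂ : Grounding c₂.subst c₂.clause)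
    (hb₁ : clauseBelow prec (clauseSubst c₁.clause c₁.subst) β)
    (hb₂ : clauseBelow prec (clauseSubst c₂.clause c₂.subst) β) :
    clauseBelow prec (clauseSubst out.clause out.subst) β := by
  obtain ⟨⟨b, l₁, r₁, l₂, r₂, e₁, e₂, hlt, hp, eo⟩, hrest⟩ := h.rewritesInstance h₁ h₂
  rw [LitClosure.clauseSubst_clause, clauseBelow_iff] at *
  rw [eo, hrest]
  intro K hK
  rcases Multiset.mem_cons.1 hK with rfl | hK
  · have := hb₂ _ (Multiset.mem_cons_self _ _)
    rw [e₂, litBelow_mkLit] at this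
    exact litBelow_mkLit.2 ⟨hprec.trans _ _ _ (hprec.replaceAt hp hlt) this.1, this.2⟩
  · rcases Multiset.mem_add.1 hK with hK | hK
    exacts [hb₁ _ (Multiset.mem_cons_of_mem hK), hb₂ _ (Multiset.mem_cons_of_mem hK)]

/-- Soundness of paramodulation. If the two instantiated premises are satisfied only through their
distinguished literals, the equation makes the replaced subterm and its replacement denote the same
element, so the rewritten literal holds. -/
theorem DisjointRewriteInference.modelsClause {M : Type*} [L.Structure M]
    {c₁ c₂ out : LitClosure L V} {p : List ℕ} (h : DisjointRewriteInference prec c₁ c₂ p out)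
    (h₁ : ModelsClause M c₁.clause) (h₂ : ModelsClause M c₂.clause) :
    ModelsClause M out.clause := by
  obtain ⟨b, l₁, r₁, l₂, r₂, s, δ, ρ, μ, hc₁, hc₂, -, -, -, -, hs, hμ, hlit, hrest, -⟩ := h
  intro a
  have hu : s.subst μ = l₁.subst μ := hμ.unifies (s, l₁) rfl
  have hrst : ∀ H ∈ out.rest, H.Holds a → ∃ K ∈ out.clause, K.Holds a := fun H hH hh =>
    ⟨H, Multiset.mem_cons_of_mem hH, hh⟩
  rw [hrest] at hrst
  obtain ⟨K₁, hK₁, hh₁⟩ := h₁.clauseSubst μ a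
  obtain ⟨K₂, hK₂, hh₂⟩ := (h₂.clauseSubst δ).clauseSubst μ a
  rw [LitClosure.clause, clauseSubst, Multiset.map_cons, Multiset.mem_cons] at hK₁
  rw [LitClosure.clause, clauseSubst_clauseSubst, clauseSubst, Multiset.map_cons,
    Multiset.mem_cons] at hK₂
  rcases hK₁ with rfl | hK₁
  · rcases hK₂ with rfl | hK₂
    · refine ⟨out.lit, Multiset.mem_cons_self _ _, ?_⟩
      rw [hc₁, mkLit_subst, holds_mkLit] at hh₁
      rw [hc₂, mkLit_subst, holds_mkLit, ← subst_subst, ← subst_subst] at hh₂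
      have hs' := subtermAt_subst hs μ
      rw [hlit, holds_mkLit, replaceAt_subst hs, realize_replaceAt hs']
      · exact hh₂
      · rw [hu]
        exact (hh₁.1 rfl).symm
    · refine hrst _ (Multiset.mem_add.2 (Or.inr ?_)) hh₂
      rw [clauseSubst_clauseSubst]
      exact hK₂
  · exact hrst _ (Multiset.mem_add.2 (Or.inl hK₁)) hh₁

theorem RewriteInference.modelsClause {M : Type*} [L.Structure M]
    {c₁ c₂ out : LitClosure L V} {p : List ℕ} (h : RewriteInference prec c₁ c₂ p out)
    (h₁ : ModelsClause M c₁.clause) (h₂ : ModelsClause M c₂.clause) :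
    ModelsClause M out.clause := by
  obtain ⟨ρ₁, ρ₂, h⟩ := h
  refine h.modelsClause ?_ ?_ <;> rw [LitClosure.rename_clause]
  exacts [h₁.clauseSubst _, h₂.clauseSubst _]

/-- Premises occur earlier in the list, so a property of the available closures that inferences
preserve holds throughout the chain. -/
theorem ReductionChain.induction {avail : Set (LitClosure L V)} {P : List (RewriteStep L V)}
    (hP : ReductionChain prec avail P) {Q : LitClosure L V → Prop} (havail : ∀ c ∈ avail, Q c)
    (hinf : ∀ c₁ c₂ p out, Q c₁ → Q c₂ → RewriteInference prec c₁ c₂ p out → Q out) :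
    ∀ I ∈ P, Q I.closure := by
  induction P using List.reverseRecOn with
  | nil => simp
  | append_singleton P J ih =>
    have hprev : ∀ I ∈ P, Q I.closure := ih fun P₁ I P₂ h =>
      hP P₁ I (P₂ ++ [J]) (by simp [h])
    intro I hI
    rcases List.mem_append.1 hI with hI | hI
    · exact hprev I hI
    · obtain rfl : I = J := by simpa using hI
      have hJ := hP P I [] rfl
      cases I with
      | leaf c => exact havail c hJ
      | infer c R S p =>
        obtain ⟨hR, hS, h⟩ := hJ
        exact hinf _ _ p c (hprev R hR) (hprev S hS) h

end Inferences

/-! ### Trail invariants, monotone levels and literals of level `0`. -/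

section TrailLemmas

variable {L : FirstOrder.Language.{u, 0}} {V : Type v} {prec : L.Term V → L.Term V → Prop}
  {β : L.Term V} {N N' : Set (Clause L V)} {Γ Γ' : Trail L V}

theorem lits_concat (Γ : Trail L V) (e : AnnLit L V) :
    lits (Γ ++ [e]) = insert e.inst (lits Γ) := by
  ext K
  simp [lits, or_and_right, exists_or, or_comm, eq_comm]

theorem lits_subset_append (Γ Γ' : Trail L V) : lits Γ ⊆ lits (Γ ++ Γ') := by
  rintro K ⟨e, he, rfl⟩
  exact ⟨e, List.mem_append_left _ he, rfl⟩

theorem lastLevel_concat (Γ : Trail L V) (e : AnnLit L V) : lastLevel (Γ ++ [e]) = e.level := by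
  simp [lastLevel]

theorem consistent_lits_nil : Consistent (lits ([] : Trail L V)) := by
  let i : L.Structure PUnit.{u + 1} := ⟨fun _ _ => PUnit.unit, fun _ _ => False⟩
  refine consistent_iff.2 ⟨PUnit, i, inferInstance, ?_⟩
  rintro K ⟨e, he, -⟩
  simp at he

/-- The invariant satisfied by a trail entry `e` that follows the trail prefix `Γ`. -/
structure EntrySound (prec : L.Term V → L.Term V → Prop) (β : L.Term V) (N : Set (Clause L V))
    (Γ : Trail L V) (e : AnnLit L V) : Prop where
  grounding : Grounding e.closure.subst e.closure.clause
  undefined : LitUndefined (lits Γ) e.inst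
  irreducible : e.inst.Irreducible (conv prec (lits Γ))
  entailed : Entails N e.closure.clause
  below : clauseBelow prec (clauseSubst e.closure.clause e.closure.subst) β
  level : IsDecision Γ e ∧ e.closure.rest = {e.closure.lit.comp} ∨
    e.level = lastLevel Γ ∧ ClauseFalse (lits Γ) (clauseSubst e.closure.rest e.closure.subst)

/-- The invariant satisfied by the trail of a state. -/
structure TrailSound (prec : L.Term V → L.Term V → Prop) (β : L.Term V) (N : Set (Clause L V))
    (Γ : Trail L V) : Prop where
  consistent : Consistent (lits Γ)
  entry : ∀ Γ₁ e Γ₂, Γ = Γ₁ ++ e :: Γ₂ → EntrySound prec β N Γ₁ e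

theorem trailSound_nil : TrailSound prec β N [] :=
  ⟨consistent_lits_nil, fun _ _ _ h => by simp at h⟩

theorem TrailSound.mono (h : TrailSound prec β N Γ) (hN : N ⊆ N') : TrailSound prec β N' Γ :=
  ⟨h.consistent, fun Γ₁ e Γ₂ hΓ =>
    { h.entry Γ₁ e Γ₂ hΓ with entailed := (h.entry Γ₁ e Γ₂ hΓ).entailed.mono hN }⟩

theorem Consistent.mono {G G' : Set (Lit L V)} (h : Consistent G') (hG : G ⊆ G') :
    Consistent G := by
  obtain ⟨M, i, hM, hG'⟩ := consistent_iff.1 h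
  exact consistent_iff.2 ⟨M, i, hM, hG'.mono hG⟩

theorem TrailSound.of_append (h : TrailSound prec β N (Γ ++ Γ')) : TrailSound prec β N Γ :=
  ⟨h.consistent.mono (lits_subset_append Γ Γ'), fun Γ₁ e Γ₂ hΓ =>
    h.entry Γ₁ e (Γ₂ ++ Γ') (by simp [hΓ])⟩

theorem TrailSound.last {e : AnnLit L V} (h : TrailSound prec β N (Γ ++ [e])) :
    EntrySound prec β N Γ e := h.entry Γ e [] rfl

theorem EntrySound.inst_isGround {e : AnnLit L V} (he : EntrySound prec β N Γ e) :
    e.inst.IsGround :=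
  he.grounding _ (mem_clauseSubst.2 ⟨_, Multiset.mem_cons_self _ _, rfl⟩)

theorem TrailSound.concat {e : AnnLit L V} (h : TrailSound prec β N Γ)
    (he : EntrySound prec β N Γ e) : TrailSound prec β N (Γ ++ [e]) := by
  refine ⟨lits_concat Γ e ▸ consistent_insert he.inst_isGround he.undefined, ?_⟩
  intro Γ₁ e' Γ₂ hΓ
  rcases List.eq_nil_or_concat Γ₂ with rfl | ⟨Γ₃, x, rfl⟩
  · obtain ⟨rfl, h'⟩ := List.append_inj' hΓ rfl
    obtain rfl : e = e' := by simpa using h'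
    exact he
  · refine h.entry Γ₁ e' Γ₃ ?_
    rw [List.concat_eq_append, ← List.cons_append, ← List.append_assoc] at hΓ
    exact (List.append_inj' hΓ rfl).1

theorem TrailSound.entry_of_mem (h : TrailSound prec β N Γ) {e : AnnLit L V} (he : e ∈ Γ) :
    ∃ Γ₁ Γ₂, Γ = Γ₁ ++ e :: Γ₂ ∧ EntrySound prec β N Γ₁ e := by
  obtain ⟨Γ₁, Γ₂, rfl⟩ := List.append_of_mem he
  exact ⟨Γ₁, Γ₂, rfl, h.entry _ _ _ rfl⟩

theorem ClauseFalse.mono {G G' : Set (Lit L V)} {C : Clause L V} (h : ClauseFalse G C)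
    (hG : G ⊆ G') : ClauseFalse G' C := fun K hK => LitEntails.mono (h K hK) hG

/-- For a propagated entry the rest was already false in its prefix. For a decision it is the
complement of the decided literal, which becomes false once that literal is on the trail. Thus both
kinds of annotation can serve as premises in a chain for Propagate. -/
theorem TrailSound.rest_false (h : TrailSound prec β N Γ) {e : AnnLit L V} (he : e ∈ Γ) :
    ClauseFalse (lits Γ) (clauseSubst e.closure.rest e.closure.subst) := by
  obtain ⟨Γ₁, Γ₂, hΓ, hs⟩ := h.entry_of_mem he
  rcases hs.level with ⟨-, hr⟩ | ⟨-, hf⟩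
  · rw [hr]
    intro K hK
    obtain ⟨H, hH, rfl⟩ := mem_clauseSubst.1 hK
    rw [Multiset.mem_singleton.1 hH, Lit.comp_subst, LitFalse, Lit.comp_comp]
    exact litEntails_of_mem ⟨e, he, rfl⟩
  · exact hf.mono (hΓ ▸ lits_subset_append Γ₁ _)

theorem EntrySound.lastLevel_le {e : AnnLit L V} (he : EntrySound prec β N Γ e) :
    lastLevel Γ ≤ e.level := by
  rcases he.level with ⟨h, -⟩ | ⟨h, -⟩
  · rw [IsDecision] at h
    omega
  · exact h.ge

theorem TrailSound.level_le_lastLevel (h : TrailSound prec β N Γ) :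
    ∀ e ∈ Γ, e.level ≤ lastLevel Γ := by
  induction Γ using List.reverseRecOn with
  | nil => simp
  | append_singleton Γ e ih =>
    intro e' he'
    rw [lastLevel_concat]
    rcases List.mem_append.1 he' with he' | he'
    · exact (ih h.of_append e' he').trans h.last.lastLevel_le
    · rw [List.mem_singleton.1 he']

theorem TrailSound.pairwise_level (h : TrailSound prec β N Γ) :
    Γ.Pairwise fun e e' => e.level ≤ e'.level := by
  induction Γ using List.reverseRecOn with
  | nil => simp
  | append_singleton Γ e ih =>
    refine List.pairwise_append.2 ⟨ih h.of_append, by simp, fun e' he' x hx => ?_⟩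
    rw [List.mem_singleton.1 hx]
    exact (h.of_append.level_le_lastLevel e' he').trans h.last.lastLevel_le

theorem TrailSound.level_mono (h : TrailSound prec β N Γ) {i j : Fin Γ.length} (hij : i ≤ j) :
    (Γ.get i).level ≤ (Γ.get j).level := by
  rcases hij.eq_or_lt with rfl | hlt
  · exact le_rfl
  · exact List.pairwise_iff_get.1 h.pairwise_level i j hlt

/-- Literals of level `0` hold in all models of the clause set. -/
theorem TrailSound.holds_of_level_zero (h : TrailSound prec β N Γ) {M : Type u} [L.Structure M]
    [Nonempty M] (hM : ∀ C ∈ N, ModelsClause M C) :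
    ∀ e ∈ Γ, e.level = 0 → ∀ a : V → M, e.inst.Holds a := by
  induction Γ using List.reverseRecOn with
  | nil => simp
  | append_singleton Γ e ih =>
    have ih := ih h.of_append
    intro e' he' h0 a
    rcases List.mem_append.1 he' with he' | he'
    · exact ih e' he' h0 a
    · obtain rfl := List.mem_singleton.1 he'
      have hlast := h.last
      rcases hlast.level with ⟨hd, -⟩ | ⟨hl, hf⟩
      · rw [IsDecision] at hd
        omega
      · have hΓ : ModelsLits M (lits Γ) := by
          rintro K ⟨x, hx, rfl⟩
          refine ih x hx ?_
          have := h.of_append.level_le_lastLevel x hx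
          omega
        obtain ⟨K, hK, hh⟩ := ((hlast.entailed M hM).clauseSubst e'.closure.subst) a
        rw [LitClosure.clauseSubst_clause] at hK
        rcases Multiset.mem_cons.1 hK with rfl | hK
        · exact hh
        · exact absurd hh (Lit.holds_comp.1 (litEntails_iff.1 (hf K hK) M hΓ a))

theorem subLits_subset (S : Set (Fin Γ.length)) : subLits Γ S ⊆ lits Γ := by
  rintro K ⟨i, -, rfl⟩
  exact ⟨_, List.get_mem _ _, rfl⟩

theorem lits_subset_subLits_univ : lits Γ ⊆ subLits Γ Set.univ := by
  rintro K ⟨e, he, rfl⟩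
  obtain ⟨i, rfl⟩ := List.mem_iff_get.1 he
  exact ⟨i, trivial, rfl⟩

theorem LitDefined.mono {G G' : Set (Lit L V)} {K : Lit L V} (h : LitDefined G K) (hG : G ⊆ G') :
    LitDefined G' K := h.imp (fun h => LitEntails.mono h hG) (fun h => LitEntails.mono h hG)

/-- The level `0` assigned in the absence of a defining literal is meaningful: if no core were
empty, each core would have a last literal, and an earliest one among these would be defining. -/
theorem litDefined_empty_of_not_isDefining {K : Lit L V} (hK : LitDefined (lits Γ) K)
    (h : ¬ ∃ i, IsDefining Γ K i) : LitDefined (subLits Γ ∅) K := by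
  by_contra h0
  have hne : ∀ S, IsCore Γ K S → ∃ i, IsGreatest S i := by
    intro S hS
    rcases S.eq_empty_or_nonempty with rfl | hne
    · exact absurd hS.1 h0
    · obtain ⟨i, hi, hmax⟩ := Set.exists_max_image S id S.toFinite hne
      exact ⟨i, hi, hmax⟩
  -- A core exists: the trail is finite and defines `K`, so some subsequence is minimal with this
  -- property.
  obtain ⟨S, hS, hmin⟩ := wellFounded_lt.has_min {S | LitDefined (subLits Γ S) K}
    ⟨Set.univ, hK.mono lits_subset_subLits_univ⟩
  have hcore : IsCore Γ K S := ⟨hS, fun S' hS' hd => hmin S' hd hS'⟩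
  obtain ⟨i₀, hi₀⟩ := hne S hcore
  obtain ⟨i, ⟨T, hT, hTi⟩, himin⟩ := wellFounded_lt.has_min
    {i | ∃ S, IsCore Γ K S ∧ IsGreatest S i} ⟨i₀, S, hcore, hi₀⟩
  refine h ⟨i, T, hT, hTi, fun S' hS' => ?_⟩
  obtain ⟨j, hj⟩ := hne S' hS'
  exact ⟨j, hj, not_lt.1 (himin j ⟨S', hS', hj⟩)⟩

/-- A false literal of level `0` is false in all models of the clause set. -/
theorem TrailSound.comp_holds_of_litLevel_zero (h : TrailSound prec β N Γ) {K : Lit L V}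
    (hK : LitFalse (lits Γ) K) (h0 : LitLevel Γ K 0) {M : Type u} [L.Structure M] [Nonempty M]
    (hM : ∀ C ∈ N, ModelsClause M C) (a : V → M) : K.comp.Holds a := by
  have key : ∀ S : Set (Fin Γ.length), (∀ i ∈ S, (Γ.get i).level = 0) →
      LitDefined (subLits Γ S) K → K.comp.Holds a := by
    intro S hS hd
    -- The subsequence cannot make `K` true, since the consistent trail makes it false.
    have hf : LitFalse (subLits Γ S) K := hd.resolve_left fun ht =>
      h.consistent.not_true_false (LitEntails.mono ht (subLits_subset S)) hK
    refine litEntails_iff.1 hf M ?_ a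
    rintro H ⟨i, hi, rfl⟩
    exact h.holds_of_level_zero hM _ (List.get_mem _ _) (hS i hi)
  rcases h0 with ⟨e, he, rfl, -⟩ | ⟨-, hd, ⟨i, ⟨S, hS, hSi, -⟩, hi⟩ | ⟨hn, -⟩⟩
  -- A false literal is not itself on a consistent trail.
  · exact (h.consistent.not_true_false (litEntails_of_mem ⟨e, he, rfl⟩) hK).elim
  · refine key S (fun j hj => ?_) hS.1
    -- All members of the core precede or equal the defining literal, whose level is `0`.
    have := h.level_mono (hSi.2 hj)
    omega
  · exact key ∅ (by simp) (litDefined_empty_of_not_isDefining hd hn)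

end TrailLemmas

/-! ### Properties transported along reduction chains from a sound trail. -/

section ChainLemmas

variable {L : FirstOrder.Language.{u, 0}} {V : Type v} {prec : L.Term V → L.Term V → Prop}
  {β : L.Term V} {N : Set (Clause L V)} {Γ : Trail L V} {c : LitClosure L V}
  {P : List (RewriteStep L V)} {I : RewriteStep L V}

theorem TrailSound.chain_grounding (h : TrailSound prec β N Γ)
    (hP : ReductionChain prec (available Γ c) P) (hc : Grounding c.subst c.clause) :
    ∀ I ∈ P, Grounding I.closure.subst I.closure.clause := by
  refine hP.induction (Q := fun c => Grounding c.subst c.clause) ?_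
    fun c₁ c₂ p out h₁ h₂ hi => hi.grounding h₁ h₂
  rintro c' (rfl | ⟨e, he, rfl⟩)
  · exact hc
  · obtain ⟨Γ₁, Γ₂, -, hs⟩ := h.entry_of_mem he
    exact hs.grounding

theorem TrailSound.chain_entails (h : TrailSound prec β N Γ)
    (hP : ReductionChain prec (available Γ c) P) (hc : Entails N c.clause) :
    ∀ I ∈ P, Entails N I.closure.clause := by
  refine hP.induction (Q := fun c => Entails N c.clause) ?_
    fun c₁ c₂ p out h₁ h₂ hi M _ _ hM => hi.modelsClause (h₁ M hM) (h₂ M hM)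
  rintro c' (rfl | ⟨e, he, rfl⟩)
  · exact hc
  · obtain ⟨Γ₁, Γ₂, -, hs⟩ := h.entry_of_mem he
    exact hs.entailed

theorem TrailSound.chain_below (hprec : IsDesired prec) (h : TrailSound prec β N Γ)
    (hP : ReductionChain prec (available Γ c) P) (hc : Grounding c.subst c.clause)
    (hb : clauseBelow prec (clauseSubst c.clause c.subst) β) :
    ∀ I ∈ P, clauseBelow prec (clauseSubst I.closure.clause I.closure.subst) β := by
  have := hP.induction (Q := fun c => Grounding c.subst c.clause ∧
    clauseBelow prec (clauseSubst c.clause c.subst) β) ?_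
    fun c₁ c₂ p out h₁ h₂ hi => ⟨hi.grounding h₁.1 h₂.1, hi.clauseBelow hprec h₁.1 h₂.1 h₁.2 h₂.2⟩
  · exact fun I hI => (this I hI).2
  rintro c' (rfl | ⟨e, he, rfl⟩)
  · exact ⟨hc, hb⟩
  · obtain ⟨Γ₁, Γ₂, -, hs⟩ := h.entry_of_mem he
    exact ⟨hs.grounding, hs.below⟩

theorem TrailSound.chain_rest_false (h : TrailSound prec β N Γ)
    (hP : ReductionChain prec (available Γ c) P) (hc : Grounding c.subst c.clause)
    (hf : ClauseFalse (lits Γ) (clauseSubst c.rest c.subst)) :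
    ∀ I ∈ P, ClauseFalse (lits Γ) (clauseSubst I.closure.rest I.closure.subst) := by
  have := hP.induction (Q := fun c => Grounding c.subst c.clause ∧
    ClauseFalse (lits Γ) (clauseSubst c.rest c.subst)) ?_ ?_
  · exact fun I hI => (this I hI).2
  · rintro c' (rfl | ⟨e, he, rfl⟩)
    · exact ⟨hc, hf⟩
    · obtain ⟨Γ₁, Γ₂, -, hs⟩ := h.entry_of_mem he
      exact ⟨hs.grounding, h.rest_false he⟩
  · rintro c₁ c₂ p out h₁ h₂ hi
    refine ⟨hi.grounding h₁.1 h₂.1, ?_⟩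
    rw [(hi.rewritesInstance h₁.1 h₂.1).rest]
    intro K hK
    rcases Multiset.mem_add.1 hK with hK | hK
    exacts [h₁.2 K hK, h₂.2 K hK]

theorem ReducesLit.normalForm (hP : ReducesLit prec Γ c P) (hI : P.getLast? = some I) :
    LitNormalForm (conv prec (lits Γ)) c.inst I.closure.inst := by
  obtain ⟨-, J, hJ, h⟩ := hP
  rw [hI] at hJ
  cases hJ
  exact h

theorem LitNormalForm.litUndefined {G : Set (Lit L V)} {K H : Lit L V}
    (h : LitNormalForm (conv prec G) K H) (hK : LitUndefined G K) : LitUndefined G H :=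
  (litUndefined_congr fun _ _ _ hM => h.holds_iff hM).1 hK

end ChainLemmas

/-! ### Preservation of the invariant by each rule. -/

section Soundness

variable {L : FirstOrder.Language.{u, 0}} {V : Type v} {prec : L.Term V → L.Term V → Prop}

/-- The invariant satisfied by the states of a run. -/
structure StateInvariant (prec : L.Term V → L.Term V → Prop) (S : State L V) : Prop where
  trail : TrailSound prec S.β (S.N ∪ S.U) S.Γ
  level : S.k = lastLevel S.Γ
  learned : ∀ C ∈ S.U, Entails S.N C
  conflict : ∀ C σ, S.D = .conflict C σ →
    Grounding σ C ∧ ClauseBFalse prec S.β (lits S.Γ) (clauseSubst C σ) ∧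
    Entails (S.N ∪ S.U) C
  bot : S.D = .bot → Entails (S.N ∪ S.U) 0

theorem StateInvariant.sound {S : State L V} (h : StateInvariant prec S) : Sound prec S where
  consistent := h.trail.consistent
  grounding e he := by
    obtain ⟨Γ₁, Γ₂, -, hs⟩ := h.trail.entry_of_mem he
    exact hs.grounding
  propagated Γ₁ e Γ₂ hΓ hd := by
    have hs := h.trail.entry Γ₁ e Γ₂ hΓ
    have hf := hs.level.resolve_left fun h => hd h.1
    refine ⟨⟨?_, hf.2⟩, Or.inr hs.undefined, hs.irreducible, hs.entailed, hs.below⟩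
    have hb := hs.below
    rw [LitClosure.clauseSubst_clause, clauseBelow_iff] at hb
    exact clauseBelow_iff.2 fun K hK => hb K (Multiset.mem_cons_of_mem hK)
  decision Γ₁ e Γ₂ hΓ hd := by
    have hs := h.trail.entry Γ₁ e Γ₂ hΓ
    refine ⟨?_, Or.inr hs.undefined, hs.irreducible, hs.entailed, hs.below⟩
    rcases hs.level with ⟨-, hr⟩ | ⟨hl, -⟩
    · exact hr
    · rw [IsDecision] at hd
      omega
  learned := h.learned
  conflict := h.conflict
  bot := h.bot

theorem stateInvariant_initialState (N : Set (Clause L V)) (β : L.Term V) :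
    StateInvariant prec (initialState N β) where
  trail := trailSound_nil
  level := rfl
  learned C hC := by simp [initialState] at hC
  conflict C σ h := by simp [initialState] at h
  bot h := by simp [initialState] at h

variable {Γ Γ' : Trail L V} {N U : Set (Clause L V)} {β : L.Term V} {k : ℕ}

theorem StateInvariant.changeTrail {D : Status L V}
    (h : StateInvariant prec ⟨Γ, N, U, β, k, D⟩) {e : AnnLit L V} {k' : ℕ} (hk : k' = e.level)
    (he : EntrySound prec β (N ∪ U) Γ e) :
    StateInvariant prec ⟨Γ ++ [e], N, U, β, k', .top⟩ where
  trail := h.trail.concat he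
  level := by simp [lastLevel_concat, hk]
  learned := h.learned
  conflict C σ h := by simp at h
  bot h := by simp at h

theorem StateInvariant.changeConflict {D : Status L V}
    (h : StateInvariant prec ⟨Γ, N, U, β, k, D⟩) {C : Clause L V} {σ : Subst L V}
    (hg : Grounding σ C) (hf : ClauseBFalse prec β (lits Γ) (clauseSubst C σ))
    (he : Entails (N ∪ U) C) : StateInvariant prec ⟨Γ, N, U, β, k, .conflict C σ⟩ where
  trail := h.trail
  level := h.level
  learned := h.learned
  conflict C' σ' heq := by
    cases heq
    exact ⟨hg, hf, he⟩
  bot h := by simp at h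

/-- Factoring first yields a closure `c` with the ground literal `Kσ`, false rest and bound `β`. The
chain transports everything but undefinedness and irreducibility, which come from the normal form.
-/
theorem StateInvariant.propagate (hprec : IsDesired prec)
    (h : StateInvariant prec ⟨Γ, N, U, β, k, .top⟩) {C₀ C₁ : Clause L V}
    {K : Lit L V} {σ μ : Subst L V} {b : Bool} {s t : L.Term V}
    {Q : Multiset (L.Term V × L.Term V)} {P : List (RewriteStep L V)} {I : RewriteStep L V}
    (hmem : C₀ + C₁ + {K} ∈ N ∪ U) (hg : Grounding σ (C₀ + C₁ + {K}))
    (hf : ClauseFalse (lits Γ) (clauseSubst C₀ σ)) (hK : K = mkLit b s t)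
    (hC₁ : C₁ = Q.map (fun q => mkLit b q.1 q.2))
    (hQ : ∀ q ∈ Q, q.1.subst σ = s.subst σ ∧ q.2.subst σ = t.subst σ)
    (hμ : IsMGU μ {e | ∃ q ∈ Q, e = (q.1, s) ∨ e = (q.2, t)})
    (hu : LitBUndefined prec β (lits Γ) (K.subst σ))
    (hb : clauseBelow prec (clauseSubst (clauseSubst (C₀ + {K}) μ) σ) β)
    (hP : ReductionChainApplication prec Γ ⟨K.subst μ, clauseSubst C₀ μ, σ⟩ P)
    (hI : P.getLast? = some I) :
    StateInvariant prec ⟨Γ ++ [⟨I.closure, k⟩], N, U, β, k, .top⟩ := by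
  have hμσ : μ.comp σ = σ := hμ.comp_eq (by
    rintro e ⟨q, hq, rfl | rfl⟩
    exacts [(hQ q hq).1, (hQ q hq).2])
  set c : LitClosure L V := ⟨K.subst μ, clauseSubst C₀ μ, σ⟩ with hc
  have hcl : c.clause = clauseSubst (C₀ + {K}) μ := by
    simp [hc, LitClosure.clause, clauseSubst, add_comm C₀]
  have hinst : c.inst = K.subst σ := by
    simp [hc, LitClosure.inst, Lit.subst_subst, hμσ]
  have hcb : clauseBelow prec (clauseSubst c.clause c.subst) β := by rwa [hcl]
  have hcg : Grounding c.subst c.clause := by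
    rw [hcl, Grounding, clauseSubst_clauseSubst, hμσ]
    intro H hH
    obtain ⟨J, hJ, rfl⟩ := mem_clauseSubst.1 hH
    refine hg _ (mem_clauseSubst.2 ⟨J, ?_, rfl⟩)
    simp only [Multiset.mem_add] at hJ ⊢
    tauto
  have hce : Entails (N ∪ U) c.clause := by
    refine ((entails_of_mem hmem).clauseSubst μ).subset ?_
    rw [hcl]
    intro H hH
    obtain ⟨J, hJ, rfl⟩ := mem_clauseSubst.1 hH
    simp only [Multiset.mem_add, Multiset.mem_singleton] at hJ
    -- Under `μ` the literals of `C₁` all collapse to that of `K`, so dropping them leaves the same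
    -- set of literals.
    rcases hJ with (hJ | hJ) | rfl
    · exact mem_clauseSubst.2 ⟨J, by simp [hJ], rfl⟩
    · rw [hC₁] at hJ
      obtain ⟨q, hq, rfl⟩ := Multiset.mem_map.1 hJ
      refine mem_clauseSubst.2 ⟨K, by simp, ?_⟩
      have h₁ : q.1.subst μ = s.subst μ := hμ.unifies (q.1, s) ⟨q, hq, Or.inl rfl⟩
      have h₂ : q.2.subst μ = t.subst μ := hμ.unifies (q.2, t) ⟨q, hq, Or.inr rfl⟩
      rw [hK, mkLit_subst, mkLit_subst, h₁, h₂]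
    · exact mem_clauseSubst.2 ⟨J, by simp, rfl⟩
  have hcf : ClauseFalse (lits Γ) (clauseSubst c.rest c.subst) := by
    rw [hc]
    dsimp only
    rwa [clauseSubst_clauseSubst, hμσ]
  have hcu : LitUndefined (lits Γ) c.inst := by
    rw [hinst]
    refine hprec.litUndefined hu ?_
    rw [← hinst]
    rw [LitClosure.clauseSubst_clause] at hcb
    exact clauseBelow_iff.1 hcb _ (Multiset.mem_cons_self _ _)
  have hmemI : I ∈ P := List.mem_of_getLast? hI
  have hchain := hP.1.1
  have hnf := hP.1.normalForm hI
  exact h.changeTrail rfl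
    { grounding := h.trail.chain_grounding hchain hcg I hmemI
      undefined := hnf.litUndefined hcu
      irreducible := hnf.irreducible
      entailed := h.trail.chain_entails hchain hce I hmemI
      below := h.trail.chain_below hprec hchain hcg hcb I hmemI
      level := Or.inr ⟨h.level, h.trail.chain_rest_false hchain hcg hcf I hmemI⟩ }

/-- Only the last distinguished literal of the chain is kept. Paired with its complement it gives a
tautology, and groundness and the bound pass from a literal to its complement. -/
theorem StateInvariant.decide (hprec : IsDesired prec)
    (h : StateInvariant prec ⟨Γ, N, U, β, k, .top⟩) {C₀ : Clause L V}
    {K : Lit L V} {σ : Subst L V} {P : List (RewriteStep L V)} {I : RewriteStep L V}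
    (hg : Grounding σ (C₀ + {K}))
    (hu : LitBUndefined prec β (lits Γ) (K.subst σ))
    (hb : clauseBelow prec (clauseSubst (C₀ + {K}) σ) β)
    (hP : ReductionChainApplication prec Γ ⟨K, C₀, σ⟩ P) (hI : P.getLast? = some I) :
    StateInvariant prec
      ⟨Γ ++ [⟨⟨I.closure.lit, {I.closure.lit.comp}, I.closure.subst⟩, k + 1⟩],
        N, U, β, k + 1, .top⟩ := by
  set c : LitClosure L V := ⟨K, C₀, σ⟩ with hc
  have hcl : c.clause = C₀ + {K} := by
    simp [hc, LitClosure.clause, add_comm C₀]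
  have hcb : clauseBelow prec (clauseSubst c.clause c.subst) β := by rwa [hcl]
  have hcg : Grounding c.subst c.clause := by rwa [hcl]
  have hcu : LitUndefined (lits Γ) c.inst :=
    hprec.litUndefined hu (clauseBelow_iff.1 hb _ (mem_clauseSubst.2 ⟨K, by simp, rfl⟩))
  have hmemI : I ∈ P := List.mem_of_getLast? hI
  have hchain := hP.1.1
  have hnf := hP.1.normalForm hI
  have hIg := h.trail.chain_grounding hchain hcg I hmemI
  have hIb := h.trail.chain_below hprec hchain hcg hcb I hmemI
  rw [Grounding, LitClosure.clauseSubst_clause] at hIg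
  rw [LitClosure.clauseSubst_clause, clauseBelow_iff] at hIb
  replace hIg := hIg _ (Multiset.mem_cons_self _ _)
  replace hIb := hIb _ (Multiset.mem_cons_self _ _)
  have hmem : ∀ J ∈ clauseSubst (I.closure.lit ::ₘ {I.closure.lit.comp}) I.closure.subst,
      J = I.closure.inst ∨ J = I.closure.inst.comp := by
    intro J hJ
    obtain ⟨H, hH, rfl⟩ := mem_clauseSubst.1 hJ
    rcases Multiset.mem_cons.1 hH with rfl | hH
    · exact Or.inl rfl
    · rw [Multiset.mem_singleton.1 hH]
      exact Or.inr rfl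
  refine h.changeTrail rfl
    { grounding := fun J hJ => ?_
      undefined := hnf.litUndefined hcu
      irreducible := hnf.irreducible
      entailed := entails_lit_comp _ _
      below := clauseBelow_iff.2 fun J hJ => ?_
      level := Or.inl ⟨congrArg (· + 1) h.level, rfl⟩ }
  · rcases hmem J hJ with rfl | rfl
    exacts [hIg, Lit.isGround_comp.2 hIg]
  · rcases hmem J hJ with rfl | rfl
    exacts [hIb, litBelow_comp.2 hIb]

/-- A model of the clause set would satisfy some literal of the clause instance, yet also the
complement of each of its literals, as these are false of level `0`. -/
theorem StateInvariant.conflictBot (h : StateInvariant prec ⟨Γ, N, U, β, k, .top⟩)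
    {C : Clause L V} {σ : Subst L V} (hC : C ∈ N ∪ U)
    (hf : ClauseBFalse prec β (lits Γ) (clauseSubst C σ))
    (h0 : ClauseLevel Γ (clauseSubst C σ) 0) :
    StateInvariant prec ⟨Γ, N, U, β, k, .bot⟩ where
  trail := h.trail
  level := h.level
  learned := h.learned
  conflict C σ h := by simp at h
  bot _ := by
    intro M _ _ hM a
    obtain ⟨K, hK, hh⟩ := (hM C hC).clauseSubst σ a
    obtain ⟨m, hm, hl⟩ := h0.1 K hK
    obtain rfl : m = 0 := by omega
    exact absurd hh (Lit.holds_comp.1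
      (h.trail.comp_holds_of_litLevel_zero (hf.2 K hK) hl hM a))

theorem ClauseBFalse.subset {G : Set (Lit L V)} {C D : Clause L V}
    (h : ClauseBFalse prec β G C) (hDC : D ⊆ C) : ClauseBFalse prec β G D :=
  ⟨clauseBelow_iff.2 fun K hK => clauseBelow_iff.1 h.1 K (hDC hK), fun K hK => h.2 K (hDC hK)⟩

/-- Common part of Factorize and Equality-Resolution: since `μσ = σ`, the new ground clause consists
of literals of the old one, so only entailment depends on the rule. -/
theorem StateInvariant.instantiate {C D : Clause L V} {σ μ : Subst L V}
    (h : StateInvariant prec ⟨Γ, N, U, β, k, .conflict C σ⟩) (hμσ : μ.comp σ = σ) (hD : D ⊆ C)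
    (he : Entails (N ∪ U) (clauseSubst D μ)) :
    StateInvariant prec ⟨Γ, N, U, β, k, .conflict (clauseSubst D μ) σ⟩ := by
  obtain ⟨hg, hf, -⟩ := h.conflict _ _ rfl
  have hsub : clauseSubst D σ ⊆ clauseSubst C σ := by
    intro H hH
    obtain ⟨J, hJ, rfl⟩ := mem_clauseSubst.1 hH
    exact mem_clauseSubst.2 ⟨J, hD hJ, rfl⟩
  refine h.changeConflict ?_ ?_ he
  · rw [Grounding, clauseSubst_clauseSubst, hμσ]
    exact fun K hK => hg K (hsub hK)
  · rw [clauseSubst_clauseSubst, hμσ]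
    exact hf.subset hsub

theorem StateInvariant.factorize {C : Clause L V} {σ μ : Subst L V} {b : Bool}
    {s t s' t' : L.Term V}
    (h : StateInvariant prec
      ⟨Γ, N, U, β, k, .conflict (C + {mkLit b s t} + {mkLit b s' t'}) σ⟩)
    (hs : s.subst σ = s'.subst σ) (ht : t.subst σ = t'.subst σ)
    (hμ : IsMGU μ {(s, s'), (t, t')}) :
    StateInvariant prec ⟨Γ, N, U, β, k, .conflict (clauseSubst (C + {mkLit b s t}) μ) σ⟩ := by
  obtain ⟨-, -, he⟩ := h.conflict _ _ rfl
  refine h.instantiate (hμ.comp_eq ?_) (Multiset.subset_of_le (Multiset.le_add_right _ _))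
    ((he.clauseSubst μ).subset ?_)
  · rintro e (rfl | rfl)
    exacts [hs, ht]
  · have h₁ : s.subst μ = s'.subst μ := hμ.unifies (s, s') (by simp)
    have h₂ : t.subst μ = t'.subst μ := hμ.unifies (t, t') (by simp)
    intro H hH
    obtain ⟨J, hJ, rfl⟩ := mem_clauseSubst.1 hH
    rcases Multiset.mem_add.1 hJ with hJ | hJ
    · exact mem_clauseSubst.2 ⟨J, hJ, rfl⟩
    · rw [Multiset.mem_singleton.1 hJ, mkLit_subst, ← h₁, ← h₂]
      exact mem_clauseSubst.2 ⟨mkLit b s t, by simp, rfl⟩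

theorem StateInvariant.equalityResolution {C : Clause L V} {σ μ : Subst L V} {s s' : L.Term V}
    (h : StateInvariant prec ⟨Γ, N, U, β, k, .conflict (C + {mkLit false s s'}) σ⟩)
    (hs : s.subst σ = s'.subst σ) (hμ : IsMGU μ {(s, s')}) :
    StateInvariant prec ⟨Γ, N, U, β, k, .conflict (clauseSubst C μ) σ⟩ := by
  obtain ⟨-, -, he⟩ := h.conflict _ _ rfl
  refine h.instantiate (hμ.comp_eq ?_) (Multiset.subset_of_le (Multiset.le_add_right _ _)) ?_
  · rintro e rfl
    exact hs
  · have h₁ : s.subst μ = s'.subst μ := hμ.unifies (s, s') rfl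
    intro M _ _ hM a
    obtain ⟨K, hK, hh⟩ := (he M hM).clauseSubst μ a
    rw [clauseSubst_add] at hK
    rcases Multiset.mem_add.1 hK with hK | hK
    · exact ⟨K, hK, hh⟩
    · obtain ⟨J, hJ, rfl⟩ := mem_clauseSubst.1 hK
      -- The resolved literal becomes a disequation of identical terms under `μ`, so it never holds.
      rw [Multiset.mem_singleton.1 hJ, mkLit_subst, holds_mkLit, h₁] at hh
      simp at hh

theorem StateInvariant.backtrack {K : AnnLit L V} {k' : ℕ} {C : Clause L V} {σ : Subst L V}
    (h : StateInvariant prec ⟨Γ ++ K :: Γ', N, U, β, k, .conflict C σ⟩)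
    (hk : (IsDecision Γ K ∧ k' + 1 = K.level) ∨ (¬ IsDecision Γ K ∧ k' = K.level)) :
    StateInvariant prec ⟨Γ, N, U ∪ {C}, β, k', .top⟩ where
  trail := h.trail.of_append.mono (Set.union_subset_union_right N Set.subset_union_left)
  level := by
    change k' = lastLevel Γ
    -- Removing a decision lowers the level by one and removing a propagated literal leaves it
    -- unchanged, so in both cases `k'` is the level at the end of `Γ`.
    have hl := (h.trail.entry Γ K Γ' rfl).level
    rcases hk with ⟨hd, hk⟩ | ⟨hd, hk⟩
    · rw [IsDecision] at hd
      omega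
    · exact hk.trans (hl.resolve_left fun h => hd h.1).1
  learned D hD := by
    rcases hD with hD | rfl
    · exact h.learned D hD
    · exact (h.conflict _ _ rfl).2.2.trans h.learned
  conflict C σ h := by simp at h
  bot h := by simp at h

theorem StateInvariant.step (hprec : IsDesired prec) {S S' : State L V}
    (h : StateInvariant prec S) (hstep : Step prec S S') : StateInvariant prec S' := by
  cases hstep with
  | propagate hmem hg hC hf hK hC₁ hQ hμ hu hb _ hP hI =>
    subst hC
    exact h.propagate hprec hmem hg hf hK hC₁ hQ hμ hu hb hP hI
  | decide _ hg hC _ hu hb _ hP hI =>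
    subst hC
    exact h.decide hprec hg hu hb hP hI
  | conflictBot hmem _ hf _ h0 => exact h.conflictBot hmem hf h0
  | conflict hmem hg hf _ _ => exact h.changeConflict hg hf (entails_of_mem hmem)
  | @skip Γ N U β k C σ e e' _ hf =>
    obtain ⟨hg, -, he⟩ := h.conflict _ _ rfl
    have ht : TrailSound prec β (N ∪ U) (Γ ++ [e] ++ [e']) := by simpa using h.trail
    exact ⟨ht.of_append, (lastLevel_concat _ _).symm, h.learned, fun C' σ' heq => by
      cases heq
      exact ⟨hg, hf, he⟩, fun h => by simp at h⟩
  | @exploreRefutation Γ N U β k C K σ i P I _ _ _ hP hI _ hf =>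
    obtain ⟨hg, -, he⟩ := h.conflict _ _ rfl
    have hcl : C + {K} = (⟨K, C, σ⟩ : LitClosure L V).clause := by
      simp [LitClosure.clause, add_comm C]
    rw [hcl] at hg he
    -- Groundness and entailment are inherited along the refutation, while `β`-falsity is a side
    -- condition of the rule.
    exact h.changeConflict (h.trail.chain_grounding hP.2.1.1 hg I hI) hf
      (h.trail.chain_entails hP.2.1.1 he I hI)
  | factorize hs ht hμ => exact h.factorize hs ht hμ
  | equalityResolution hs hμ => exact h.equalityResolution hs hμ
  | backtrack _ _ _ _ hk => exact h.backtrack hk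
  | grow =>
    -- The bound enters only through the trail and the conflict closure, so changing it is harmless
    -- once both are empty.
    exact ⟨trailSound_nil, rfl, h.learned, fun _ _ h => by simp at h, fun h => by simp at h⟩

end Soundness

end SCLEQ

theorem mainTheorem2 {L : FirstOrder.Language.{u, 0}} [L.IsAlgebraic] {V : Type v} [Infinite V]
    (prec : L.Term V → L.Term V → Prop) (hprec : SCLEQ.IsDesired prec)
    (N : Set (SCLEQ.Clause L V)) (β : L.Term V) (hβ : SCLEQ.IsGround β)
    (S : SCLEQ.State L V) (hS : SCLEQ.ResultsFromRun prec N β S) :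
    SCLEQ.Sound prec S := by
  have h : SCLEQ.StateInvariant prec S := by
    induction hS with
    | refl => exact SCLEQ.stateInvariant_initialState N β
    | tail _ hstep ih => exact ih.step hprec hstep
  exact h.sound
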